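/- Let $\eta=\frac{1+\sqrt{-7}}{2}$, so that $\mathbb Z[\eta]$ is the ring of integers of $\mathbb Q(\sqrt{-7})$, and let $\chi$ be the Hecke Grössencharacter given on the ideal $(a+b\eta)$ by $$\chi((a+b\eta))=\left(\frac{a^3-2a^2b-ab^2+b^3}{7}\right)(a+b\eta),$$ where $\left(\frac{\cdot}{7}\right)$ is the Legendre symbol. For odd $k\ge 1$ let $L(s,\chi^k)$ be defined for $\operatorname{Re}s>1$ by the absolutely convergent series $$L(s,\chi^k)=\frac12\sum_{(a,b)\in\mathbb Z^2\setminus\{(0,0)\}}\frac{\chi((a+b\eta))^k}{(a^2+ab+2b^2)^{s+k/2}},$$ and elsewhere by analytic continuation. **Theorem 2 (second moment upper bound).** For every integer $n\ge1$ the function $L(s,\chi^{4n-3})$ extends to an entire function of $s$. There is an absolute constant $C$ such that for all integers $N\ge2$ $$\left|\frac1N\sum_{n=1}^{N}L(1/2,\chi^{4n-3})^2\right|\le C\log^2N.$$ Moreover (the convexity bound), there is an absolute constant $C'$ such that $|L(1/2,\chi^{4n-3})|\le C'\,n^{1/2}\log n$ for all integers $n\ge2$. -/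

import Mathlib

/-- The generator `η = (1 + √-7) / 2` of the ring of integers `ℤ[η]` of `ℚ(√-7)`. -/
noncomputable def eta : ℂ := (1 + (Real.sqrt 7 : ℂ) * Complex.I) / 2

/-- The norm of `a + b η`, for `p = (a, b)`. -/
def normForm (p : ℤ × ℤ) : ℤ := p.1 ^ 2 + p.1 * p.2 + 2 * p.2 ^ 2

instance factPrimeSeven : Fact (Nat.Prime 7) := ⟨by norm_num⟩

/-- The sign `ε_{a,b}` with `(a + b η)³ ≡ ε_{a,b} mod √-7`, given as a Legendre symbol;
it is `0` if `a + b η` is not coprime to `√-7`. -/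
def eps (p : ℤ × ℤ) : ℤ :=
  legendreSym 7 (p.1 ^ 3 - 2 * p.1 ^ 2 * p.2 - p.1 * p.2 ^ 2 + p.2 ^ 3)

/-- The Hecke character `χ((a + b η)) = ε_{a,b} (a + b η)`. -/
noncomputable def heckeChi (p : ℤ × ℤ) : ℂ := (eps p : ℂ) * ((p.1 : ℂ) + (p.2 : ℂ) * eta)

/-- The term of index `(a, b)` of the series
`L(s, χ^k) = ½ ∑_{(a,b) ≠ (0,0)} χ((a + b η))^k / (a² + a b + 2 b²)^(s + k/2)`
(analytic normalisation; every ideal has two generators). -/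
noncomputable def heckeTerm (k : ℕ) (s : ℂ) (p : ℤ × ℤ) : ℂ :=
  (1 / 2) * (heckeChi p ^ k / (normForm p : ℂ) ^ (s + (k : ℂ) / 2))

/-- `F` is the entire function `s ↦ L(s, χ^k)`: it is entire, and for `Re s > 1` it is the sum of
the (absolutely convergent) Hecke series. By the identity theorem at most one `F` satisfies this. -/
def IsHeckeL (k : ℕ) (F : ℂ → ℂ) : Prop :=
  Differentiable ℂ F ∧
    ∀ s : ℂ, 1 < s.re → HasSum (fun p : {p : ℤ × ℤ // p ≠ 0} => heckeTerm k s p) (F s)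

open Classical in
/-- The Hecke `L`-function `L(s, χ^k)`: the entire function that continues the Hecke series
(the zero function should no continuation exist). -/
noncomputable def heckeL (k : ℕ) : ℂ → ℂ :=
  if h : ∃ F : ℂ → ℂ, IsHeckeL k F then h.choose else 0

/-- The moment `(1/N) ∑_{n=1}^N L(1/2, χ^(4n-3))^r`. -/
noncomputable def moment (r N : ℕ) : ℂ :=
  (1 / (N : ℂ)) * ∑ n ∈ Finset.Icc 1 N, heckeL (4 * n - 3) (1 / 2) ^ r

/-!
The theta series attached to the character of `chi7` and the harmonic polynomial `(a + b η) ^ k`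
satisfies a modular functional equation, by Poisson summation on `ℤ[η]` and the Gauss sum of `chi7`.
Its Mellin transform therefore continues `L(s, χ ^ k)` to an entire function, and splitting the
Mellin integral at `1` expresses the central value as a rapidly convergent sum over `ℤ[η]` whose
weights are Poisson tail probabilities; for `k ≪ N` this sum may be truncated to a box of radius
`≍ √N`.

Squaring and summing over `k` leaves pairs of lattice points `p, q`. When `p` and `q` are parallel,
the sum over the multiples of a primitive vector is bounded because `chi7` has bounded partial sums,
and counting by the greatest common divisor of the coordinates gives `log ^ 2 N` for each `k`.
Otherwise the sum over `k` is geometric, up to monotone weights, with a ratio whose distance to `1`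
is controlled by the determinant of `p` and `q`; it is `O(1 / |det (p, q)|)`, and summing over the
box gives `O(N log N)`.
-/

open Complex hiding eta
open Filter Topology Set MeasureTheory
open scoped Real

/-- The element `a + b η` of `ℤ[η]` attached to `p = (a, b)`. -/
noncomputable def latticePt (p : ℤ × ℤ) : ℂ := p.1 + p.2 * eta

lemma sqrt_seven_sq : (√7 : ℂ) ^ 2 = 7 := by
  rw [← ofReal_pow, Real.sq_sqrt (by norm_num)]; norm_num

lemma sqrt_seven_ne_zero : (√7 : ℂ) ≠ 0 := by
  simp

lemma eta_sq : eta ^ 2 = eta - 2 := by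
  unfold eta
  linear_combination (1 / 4 : ℂ) * I ^ 2 * sqrt_seven_sq + (7 / 4 : ℂ) * I_sq

lemma conj_eta : (starRingEnd ℂ) eta = 1 - eta := by
  unfold eta
  simp only [map_div₀, map_add, map_one, map_mul, conj_ofReal, conj_I, map_ofNat]
  ring

lemma eta_im : eta.im = √7 / 2 := by
  simp [eta]

lemma normSq_latticePt (p : ℤ × ℤ) : normSq (latticePt p) = normForm p := by
  have h : (normSq (latticePt p) : ℂ) = normForm p := by
    rw [normSq_eq_conj_mul_self, latticePt, normForm]
    simp only [map_add, map_mul, map_intCast, conj_eta]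
    push_cast
    linear_combination (-(p.2 : ℂ) ^ 2) * eta_sq
  exact_mod_cast h

lemma norm_latticePt_sq (p : ℤ × ℤ) : ‖latticePt p‖ ^ 2 = normForm p := by
  rw [← normSq_latticePt, normSq_eq_norm_sq]

lemma norm_latticePt (p : ℤ × ℤ) : ‖latticePt p‖ = √(normForm p) := by
  rw [← norm_latticePt_sq, Real.sqrt_sq (norm_nonneg _)]

lemma latticePt_smul (m : ℤ) (p : ℤ × ℤ) : latticePt (m • p) = m * latticePt p := by
  simp only [latticePt, Prod.smul_fst, Prod.smul_snd, smul_eq_mul]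
  push_cast; ring

lemma sq_add_sq_le_two_mul_normForm (p : ℤ × ℤ) : p.1 ^ 2 + p.2 ^ 2 ≤ 2 * normForm p := by
  unfold normForm; nlinarith [sq_nonneg (p.1 + p.2)]

lemma half_sq_add_sq_le_normForm (p : ℤ × ℤ) :
    ((p.1 : ℝ) ^ 2 + (p.2 : ℝ) ^ 2) / 2 ≤ normForm p := by
  have h : ((p.1 : ℝ) ^ 2 + (p.2 : ℝ) ^ 2) ≤ 2 * normForm p := by
    exact_mod_cast sq_add_sq_le_two_mul_normForm p
  linarith

lemma normForm_nonneg (p : ℤ × ℤ) : 0 ≤ normForm p := by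
  nlinarith [sq_add_sq_le_two_mul_normForm p, sq_nonneg p.1, sq_nonneg p.2]

lemma normForm_pos {p : ℤ × ℤ} (hp : p ≠ 0) : 0 < normForm p := by
  refine (normForm_nonneg p).lt_of_ne' fun h ↦ hp ?_
  have := sq_add_sq_le_two_mul_normForm p
  ext <;> simp only [Prod.fst_zero, Prod.snd_zero] <;> nlinarith [sq_nonneg p.1, sq_nonneg p.2]

lemma one_le_norm_latticePt {p : ℤ × ℤ} (hp : p ≠ 0) : 1 ≤ ‖latticePt p‖ := by
  rw [norm_latticePt, Real.one_le_sqrt]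
  exact_mod_cast normForm_pos hp

lemma abs_fst_le_two_mul_norm_latticePt (p : ℤ × ℤ) : |(p.1 : ℝ)| ≤ 2 * ‖latticePt p‖ := by
  refine abs_le_of_sq_le_sq ?_ (by positivity)
  nlinarith [norm_latticePt_sq p, half_sq_add_sq_le_normForm p, sq_nonneg (p.2 : ℝ)]

lemma abs_snd_le_two_mul_norm_latticePt (p : ℤ × ℤ) : |(p.2 : ℝ)| ≤ 2 * ‖latticePt p‖ := by
  refine abs_le_of_sq_le_sq ?_ (by positivity)
  nlinarith [norm_latticePt_sq p, half_sq_add_sq_le_normForm p, sq_nonneg (p.1 : ℝ)]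

/-- The quadratic character modulo `7`, with complex values. -/
noncomputable def chi7 : DirichletCharacter ℂ 7 :=
  (quadraticChar (ZMod 7)).ringHomComp (Int.castRingHom ℂ)

lemma chi7_isQuadratic : chi7.IsQuadratic :=
  (quadraticChar_isQuadratic (ZMod 7)).comp _

lemma ringChar_zmod_seven_ne_two : ringChar (ZMod 7) ≠ 2 := by
  rw [ZMod.ringChar_zmod_n]; norm_num

lemma chi7_ne_one : chi7 ≠ 1 :=
  (MulChar.ringHomComp_ne_one_iff Int.cast_injective).mpr
    (quadraticChar_ne_one ringChar_zmod_seven_ne_two)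

lemma chi7_four_mul (c : ZMod 7) : chi7 (4 * c) = chi7 c := by
  have h : ∀ c : ZMod 7, quadraticChar (ZMod 7) (4 * c) = quadraticChar (ZMod 7) c := by decide
  simp only [chi7, MulChar.ringHomComp_apply, h]

lemma chi7_neg_one : chi7 (-1) = -1 := by
  have h : quadraticChar (ZMod 7) (-1) = -1 := by decide
  simp [chi7, MulChar.ringHomComp_apply, h]

lemma eps_eq_chi7 (p : ℤ × ℤ) : (eps p : ℂ) = chi7 ((p.1 : ZMod 7) + 4 * (p.2 : ZMod 7)) := by
  have h : ∀ x y : ZMod 7, quadraticChar (ZMod 7) (x ^ 3 - 2 * x ^ 2 * y - x * y ^ 2 + y ^ 3) =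
      quadraticChar (ZMod 7) (x + 4 * y) := by decide
  rw [chi7, MulChar.ringHomComp_apply, ← h, eps, legendreSym]
  push_cast
  rfl

lemma norm_eps_le_one (p : ℤ × ℤ) : ‖(eps p : ℂ)‖ ≤ 1 := by
  rw [eps_eq_chi7]; exact chi7.norm_le_one _

lemma eps_pow_odd (p : ℤ × ℤ) {k : ℕ} (hk : Odd k) : (eps p : ℂ) ^ k = eps p := by
  rw [eps_eq_chi7, ← MulChar.pow_apply' _ hk.pos.ne', chi7_isQuadratic.pow_odd hk]

lemma eps_zero : (eps 0 : ℂ) = 0 := by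
  rw [eps_eq_chi7]; simp [chi7.map_zero]

lemma eps_smul (m : ℤ) (p : ℤ × ℤ) : (eps (m • p) : ℂ) = chi7 m * eps p := by
  rw [eps_eq_chi7, eps_eq_chi7, ← map_mul]
  congr 1
  simp only [Prod.smul_fst, Prod.smul_snd, smul_eq_mul]
  push_cast; ring

/-- The Gauss sum of `chi7`. -/
noncomputable def gauss7 : ℂ := gaussSum chi7 ZMod.stdAddChar

lemma norm_gauss7 : ‖gauss7‖ = √7 := by
  have h : gauss7 ^ 2 = -7 := by
    rw [gauss7, gaussSum_sq chi7_ne_one chi7_isQuadratic (ZMod.isPrimitive_stdAddChar 7),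
      chi7_neg_one, ZMod.card]
    norm_num
  rw [← Real.sqrt_sq (norm_nonneg gauss7), ← norm_pow, h, norm_neg, Complex.norm_ofNat]

lemma chi7_mul_gauss7 (c : ZMod 7) :
    chi7 c * gauss7 = ∑ j : ZMod 7, chi7 j * ZMod.stdAddChar (j * c) := by
  have hprim : chi7.IsPrimitive := by
    refine ((Nat.dvd_prime Fact.out).mp (chi7.conductor_dvd_level)).resolve_left fun h ↦ ?_
    exact chi7_ne_one (DirichletCharacter.eq_one_iff_conductor_eq_one.mpr h)
  have h := gaussSum_mulShift_of_isPrimitive ZMod.stdAddChar hprim c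
  rw [chi7_isQuadratic.inv] at h
  rw [gauss7, ← h, gaussSum]
  simp only [AddChar.mulShift_apply, mul_comm c]

lemma summable_exp_neg_quadratic {a : ℂ} (ha : 0 < a.re) (b : ℂ) :
    Summable fun n : ℤ ↦ cexp (-π * a * n ^ 2 + 2 * π * b * n) := by
  have hτ : 0 < (I * a).im := by rwa [I_mul_im]
  refine ((summable_jacobiTheta₂_term_iff (-(I * b)) (I * a)).mpr hτ).congr fun n ↦ ?_
  rw [jacobiTheta₂_term]
  congr 1
  linear_combination (π * a * n ^ 2 - 2 * π * n * b : ℂ) * I_sq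

lemma summable_exp_neg_mul_int_sq {c : ℝ} (hc : 0 < c) :
    Summable fun n : ℤ ↦ Real.exp (-c * n ^ 2) := by
  have hre : 0 < ((c / π : ℝ) : ℂ).re := by rw [ofReal_re]; positivity
  refine (summable_exp_neg_quadratic hre 0).norm.congr fun n ↦ ?_
  have h : (-π * (c / π : ℝ) * n ^ 2 + 2 * π * 0 * n : ℂ) = (-c * n ^ 2 : ℝ) := by
    push_cast; field_simp; ring
  rw [h, Complex.norm_exp, ofReal_re]

lemma summable_exp_neg_normForm_add_norm {c : ℝ} (hc : 0 < c) (r : ℝ) : Summable fun p : ℤ × ℤ ↦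
    Real.exp (-c * normForm p) * Real.exp (r * ‖latticePt p‖) := by
  have h := summable_exp_neg_mul_int_sq (by positivity : 0 < c / 4)
  refine Summable.of_nonneg_of_le (fun p ↦ by positivity) (fun p ↦ ?_)
    ((h.mul_of_nonneg h (fun _ ↦ by positivity) fun _ ↦ by positivity).mul_left
      (Real.exp (r ^ 2 / (2 * c))))
  rw [← Real.exp_add, ← Real.exp_add, ← Real.exp_add, Real.exp_le_exp]
  have amgm : r * ‖latticePt p‖ ≤ r ^ 2 / (2 * c) + c / 2 * ‖latticePt p‖ ^ 2 := by
    have : 0 ≤ (r - c * ‖latticePt p‖) ^ 2 / (2 * c) := by positivity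
    field_simp at this ⊢
    nlinarith
  rw [norm_latticePt_sq] at amgm
  nlinarith [half_sq_add_sq_le_normForm p]

/-- The general term of the two-dimensional Gaussian series attached to `normForm`. -/
noncomputable def gaussTerm (y : ℝ) (u v : ℂ) (p : ℤ × ℤ) : ℂ :=
  cexp (-π * y * normForm p + 2 * π * (u * p.1 + v * p.2))

lemma summable_gaussTerm {y : ℝ} (hy : 0 < y) (u v : ℂ) : Summable (gaussTerm y u v) := by
  refine (summable_exp_neg_normForm_add_norm (by positivity : 0 < π * y)
    (4 * π * (‖u‖ + ‖v‖))).of_norm_bounded fun p ↦ ?_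
  rw [gaussTerm, Complex.exp_add, norm_mul, Complex.norm_exp]
  have hre : (-π * y * normForm p : ℂ) = (-(π * y) * normForm p : ℝ) := by push_cast; ring
  rw [hre, ofReal_re]
  gcongr
  refine (norm_exp_le_exp_norm _).trans (Real.exp_le_exp.mpr ?_)
  calc ‖2 * π * (u * p.1 + v * p.2)‖ ≤ 2 * π * (‖u‖ * |(p.1 : ℝ)| + ‖v‖ * |(p.2 : ℝ)|) := by
        rw [norm_mul, norm_mul, norm_ofNat, norm_real, Real.norm_of_nonneg Real.pi_pos.le]
        gcongr
        refine (norm_add_le _ _).trans_eq ?_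
        rw [norm_mul, norm_mul, norm_intCast, norm_intCast]
    _ ≤ 2 * π * (‖u‖ * (2 * ‖latticePt p‖) + ‖v‖ * (2 * ‖latticePt p‖)) := by
        gcongr
        exacts [abs_fst_le_two_mul_norm_latticePt p, abs_snd_le_two_mul_norm_latticePt p]
    _ = 4 * π * (‖u‖ + ‖v‖) * ‖latticePt p‖ := by ring

/-- The general term of the Fourier dual of the series of `gaussTerm y u v`; the quadratic form is
the inverse of `normForm`, up to scaling. -/
noncomputable def dualGaussTerm (y : ℝ) (u v : ℂ) (q : ℤ × ℤ) : ℂ :=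
  cexp (-(4 * π / (7 * y)) *
    (2 * (q.1 + I * u) ^ 2 - (q.1 + I * u) * (q.2 + I * v) + (q.2 + I * v) ^ 2))

/-- The general term obtained from `gaussTerm y u v` by Poisson summation in the first variable. -/
noncomputable def semidualGaussTerm (y : ℝ) (u v : ℂ) (m b : ℤ) : ℂ :=
  cexp (-π / y * (m + I * u) ^ 2) *
    cexp (-π * (7 / 4 * y : ℝ) * b ^ 2 + 2 * π * (v + I * (m + I * u) / 2) * b)

lemma summable_dualGaussTerm {y : ℝ} (hy : 0 < y) (u v : ℂ) : Summable (dualGaussTerm y u v) := by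
  have hswap : Function.Injective fun q : ℤ × ℤ ↦ (q.2, -q.1) := fun q q' h ↦ by
    simp only [Prod.mk.injEq, neg_inj] at h
    exact Prod.ext h.2 h.1
  have h := ((summable_gaussTerm (by positivity : 0 < 4 / (7 * y))
    (-(2 * I * v - I * u) / (7 * y) * 2) ((4 * I * u - I * v) / (7 * y) * 2)).comp_injective
    hswap).mul_left (cexp (4 * π / (7 * y) * (2 * u ^ 2 - u * v + v ^ 2)))
  refine h.congr fun q ↦ ?_
  have hyC : (y : ℂ) ≠ 0 := by exact_mod_cast hy.ne'
  rw [Function.comp_apply, gaussTerm, dualGaussTerm, normForm, ← Complex.exp_add]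
  congr 1
  push_cast
  field_simp
  linear_combination (8 * u ^ 2 - 4 * u * v + 4 * v ^ 2 : ℂ) * I_sq

lemma tsum_gaussTerm_fst {y : ℝ} (hy : 0 < y) (u v : ℂ) (b : ℤ) :
    ∑' a : ℤ, gaussTerm y u v (a, b) =
      1 / (y : ℂ) ^ (1 / 2 : ℂ) * ∑' m : ℤ, semidualGaussTerm y u v m b := by
  have hyC : (y : ℂ) ≠ 0 := by exact_mod_cast hy.ne'
  have h := Complex.tsum_exp_neg_quadratic (a := y) (by simpa) (u - y * b / 2)
  calc ∑' a : ℤ, gaussTerm y u v (a, b)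
      = ∑' a : ℤ, cexp (-(2 * π * y * b ^ 2) + 2 * π * v * b) *
          cexp (-π * y * a ^ 2 + 2 * π * (u - y * b / 2) * a) := by
        refine tsum_congr fun a ↦ ?_
        rw [gaussTerm, normForm, ← Complex.exp_add]
        congr 1
        push_cast; ring
    _ = 1 / (y : ℂ) ^ (1 / 2 : ℂ) * ∑' m : ℤ, cexp (-(2 * π * y * b ^ 2) + 2 * π * v * b) *
          cexp (-π / y * (m + I * (u - y * b / 2)) ^ 2) := by
        rw [tsum_mul_left, h, tsum_mul_left, mul_left_comm]
    _ = _ := by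
        congr 1
        refine tsum_congr fun m ↦ ?_
        rw [semidualGaussTerm, ← Complex.exp_add, ← Complex.exp_add]
        congr 1
        push_cast
        field_simp
        linear_combination (-4 * y ^ 2 * b ^ 2 : ℂ) * I_sq

lemma tsum_semidualGaussTerm_snd {y : ℝ} (hy : 0 < y) (u v : ℂ) (m : ℤ) :
    ∑' b : ℤ, semidualGaussTerm y u v m b =
      1 / ((7 / 4 * y : ℝ) : ℂ) ^ (1 / 2 : ℂ) * ∑' n : ℤ, dualGaussTerm y u v (m, n) := by
  have hyC : (y : ℂ) ≠ 0 := by exact_mod_cast hy.ne'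
  have h := Complex.tsum_exp_neg_quadratic (a := (7 / 4 * y : ℝ)) (by rw [ofReal_re]; positivity)
    (v + I * (m + I * u) / 2)
  simp only [semidualGaussTerm]
  rw [tsum_mul_left, h, mul_left_comm, ← tsum_mul_left]
  congr 1
  refine tsum_congr fun n ↦ ?_
  have hI : (n + I * (v + I * (m + I * u) / 2) : ℂ) = n + I * v - (m + I * u) / 2 := by
    linear_combination ((m + I * u) / 2 : ℂ) * I_sq
  rw [dualGaussTerm, ← Complex.exp_add, hI]
  congr 1
  push_cast
  field_simp
  ring

lemma summable_semidualGaussTerm {y : ℝ} (hy : 0 < y) (u v : ℂ) :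
    Summable fun q : ℤ × ℤ ↦ semidualGaussTerm y u v q.1 q.2 := by
  have hyC : (y : ℂ) ≠ 0 := by exact_mod_cast hy.ne'
  have hre : 0 < ((1 / y : ℝ) : ℂ).re := by rw [ofReal_re]; positivity
  have hre' : 0 < ((7 / 4 * y : ℝ) : ℂ).re := by rw [ofReal_re]; positivity
  have h1 := (summable_exp_neg_quadratic hre (-I * u / y)).norm.mul_left ‖cexp (π / y * u ^ 2)‖
  have h2 := (summable_exp_neg_quadratic hre' (v - u / 2)).norm
  refine (h1.mul_of_nonneg h2 (fun _ ↦ by positivity) fun _ ↦ norm_nonneg _).of_norm_bounded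
    fun q ↦ le_of_eq ?_
  have e1 : (-π / y * (q.1 + I * u) ^ 2 : ℂ) = π / y * u ^ 2 +
      (-π * (1 / y : ℝ) * q.1 ^ 2 + 2 * π * (-I * u / y) * q.1) := by
    push_cast; field_simp; linear_combination (-u ^ 2 : ℂ) * I_sq
  have e2 : (-π * (7 / 4 * y : ℝ) * q.2 ^ 2 + 2 * π * (v + I * (q.1 + I * u) / 2) * q.2 : ℂ) =
      -π * (7 / 4 * y : ℝ) * q.2 ^ 2 + 2 * π * (v - u / 2) * q.2 + (π * q.1 * q.2 : ℝ) * I := by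
    push_cast; linear_combination (π * u * q.2 : ℂ) * I_sq
  rw [semidualGaussTerm, e1, e2, Complex.exp_add, Complex.exp_add _ (_ * I), norm_mul, norm_mul,
    norm_mul, norm_exp_ofReal_mul_I, mul_one]

lemma cpow_half_mul_cpow_half {y : ℝ} (hy : 0 < y) :
    1 / (y : ℂ) ^ (1 / 2 : ℂ) * (1 / ((7 / 4 * y : ℝ) : ℂ) ^ (1 / 2 : ℂ)) = 2 / (√7 * y) := by
  have hhalf : (1 / 2 : ℂ) = ((1 / 2 : ℝ) : ℂ) := by push_cast; ring
  have hsqrt : √y * √(7 / 4 * y) = √7 * y / 2 := by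
    rw [← Real.sqrt_mul hy.le, show y * (7 / 4 * y) = 7 * (y / 2) ^ 2 by ring,
      Real.sqrt_mul (by norm_num), Real.sqrt_sq (by positivity)]
    ring
  rw [hhalf, ← ofReal_cpow hy.le, ← ofReal_cpow (by positivity), ← Real.sqrt_eq_rpow,
    ← Real.sqrt_eq_rpow, div_mul_div_comm, ← ofReal_mul, hsqrt]
  push_cast
  field_simp

theorem tsum_gaussTerm {y : ℝ} (hy : 0 < y) (u v : ℂ) :
    ∑' p, gaussTerm y u v p = 2 / (√7 * y) * ∑' q, dualGaussTerm y u v q := by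
  have hswap : Summable fun q : ℤ × ℤ ↦ semidualGaussTerm y u v q.2 q.1 :=
    (Equiv.prodComm ℤ ℤ).summable_iff.mpr (summable_semidualGaussTerm hy u v)
  calc ∑' p, gaussTerm y u v p = ∑' b : ℤ, ∑' a : ℤ, gaussTerm y u v (a, b) := by
        rw [← (Equiv.prodComm ℤ ℤ).tsum_eq]
        exact ((Equiv.prodComm ℤ ℤ).summable_iff.mpr (summable_gaussTerm hy u v)).tsum_prod
    _ = 1 / (y : ℂ) ^ (1 / 2 : ℂ) * ∑' m : ℤ, ∑' b : ℤ, semidualGaussTerm y u v m b := by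
        rw [tsum_congr (tsum_gaussTerm_fst hy u v), tsum_mul_left,
          Summable.tsum_comm (f := fun b m ↦ semidualGaussTerm y u v m b) hswap]
    _ = 2 / (√7 * y) * ∑' m : ℤ, ∑' n : ℤ, dualGaussTerm y u v (m, n) := by
        rw [tsum_congr (tsum_semidualGaussTerm_snd hy u v), tsum_mul_left, ← mul_assoc,
          cpow_half_mul_cpow_half hy]
    _ = 2 / (√7 * y) * ∑' q, dualGaussTerm y u v q := by
        rw [(summable_dualGaussTerm hy u v).tsum_prod]

/-- The general term of the exponential generating series of the theta series with harmonic
polynomials `α ^ k`. -/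
noncomputable def thetaGenTerm (t : ℝ) (w : ℂ) (p : ℤ × ℤ) : ℂ :=
  eps p * cexp (-(2 * π / 7) * t * normForm p + w * latticePt p)

/-- The first frequency of the Gaussian series `∑ exp (-2 π t N(α) / 7 + w α)` twisted by the
additive character `a + b η ↦ exp (2 π i j (a + 4 b) / 7)`. -/
noncomputable def twistFst (w : ℂ) (j : ZMod 7) : ℂ := w / (2 * π) + I * j.val / 7

/-- The second frequency of the Gaussian series of `twistFst`. -/
noncomputable def twistSnd (w : ℂ) (j : ZMod 7) : ℂ := w * eta / (2 * π) + 4 * I * j.val / 7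

lemma stdAddChar_mul_exp_eq_gaussTerm (t : ℝ) (w : ℂ) (j : ZMod 7) (p : ℤ × ℤ) :
    ZMod.stdAddChar (j * ((p.1 : ZMod 7) + 4 * (p.2 : ZMod 7))) *
      cexp (-(2 * π / 7) * t * normForm p + w * latticePt p) =
        gaussTerm (2 * t / 7) (twistFst w j) (twistSnd w j) p := by
  have hj : j * ((p.1 : ZMod 7) + 4 * (p.2 : ZMod 7)) =
      ((j.val * (p.1 + 4 * p.2) : ℤ) : ZMod 7) := by
    push_cast; rw [ZMod.natCast_zmod_val]
  have hpi : (π : ℂ) ≠ 0 := by exact_mod_cast Real.pi_ne_zero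
  rw [hj, ZMod.stdAddChar_coe, ← Complex.exp_add, gaussTerm, latticePt, twistFst, twistSnd]
  congr 1
  push_cast
  field_simp
  ring

lemma exp_eq_gaussTerm (t : ℝ) (w : ℂ) (p : ℤ × ℤ) :
    cexp (-(2 * π / 7) * t * normForm p + w * latticePt p) =
      gaussTerm (2 * t / 7) (twistFst w 0) (twistSnd w 0) p := by
  simpa using stdAddChar_mul_exp_eq_gaussTerm t w 0 p

lemma summable_thetaGenTerm {t : ℝ} (ht : 0 < t) (w : ℂ) : Summable (thetaGenTerm t w) := by
  refine (summable_gaussTerm (by positivity : 0 < 2 * t / 7) (twistFst w 0)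
    (twistSnd w 0)).norm.of_norm_bounded fun p ↦ ?_
  rw [thetaGenTerm, norm_mul, ← exp_eq_gaussTerm]
  exact mul_le_of_le_one_left (norm_nonneg _) (norm_eps_le_one p)

lemma gauss7_mul_thetaGenTerm (t : ℝ) (w : ℂ) (p : ℤ × ℤ) : gauss7 * thetaGenTerm t w p =
    ∑ j, chi7 j * gaussTerm (2 * t / 7) (twistFst w j) (twistSnd w j) p := by
  rw [thetaGenTerm, ← mul_assoc, mul_comm gauss7, eps_eq_chi7, chi7_mul_gauss7, Finset.sum_mul]
  refine Finset.sum_congr rfl fun j _ ↦ ?_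
  rw [mul_assoc, stdAddChar_mul_exp_eq_gaussTerm]

/-- The parametrisation of `ℤ[η]` by a residue `j` modulo `√-7` and a multiple of `√-7`. -/
def residueEquiv : ZMod 7 × ℤ × ℤ ≃ ℤ × ℤ where
  toFun x := (x.2.2 - 4 * x.2.1, x.1.val - 2 * x.2.2 + x.2.1)
  invFun p := (((2 * p.1 + p.2 : ℤ) : ZMod 7), -((2 * p.1 + p.2) / 7),
    p.1 - 4 * ((2 * p.1 + p.2) / 7))
  left_inv := by
    rintro ⟨j, m, n⟩
    have hj := j.val_lt
    refine Prod.ext ?_ (Prod.ext ?_ ?_)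
    · have h : (2 * (n - 4 * m) + (j.val - 2 * n + m) : ℤ) = j.val - 7 * m := by ring
      dsimp only
      rw [h]
      push_cast
      rw [ZMod.natCast_zmod_val, show (7 : ZMod 7) = 0 from rfl, zero_mul, sub_zero]
    all_goals dsimp only; omega
  right_inv := by
    rintro ⟨a, b⟩
    simp only [ZMod.val_intCast, Prod.mk.injEq]
    omega

lemma chi7_mul_dualGaussTerm {t : ℝ} (ht : 0 < t) (w : ℂ) (j : ZMod 7) (q : ℤ × ℤ) :
    chi7 j * dualGaussTerm (2 * t / 7) (twistFst w j) (twistSnd w j) q =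
      thetaGenTerm (1 / t) (I * w / t) (residueEquiv (j, q)) := by
  have hpi : (π : ℂ) ≠ 0 := by exact_mod_cast Real.pi_ne_zero
  have htC : (t : ℂ) ≠ 0 := by exact_mod_cast ht.ne'
  have hj : chi7 j = eps (residueEquiv (j, q)) := by
    have h7 : (7 : ZMod 7) = 0 := rfl
    rw [eps_eq_chi7, ← chi7_four_mul j]
    congr 1
    simp only [residueEquiv, Equiv.coe_fn_mk]
    push_cast
    rw [ZMod.natCast_zmod_val]
    linear_combination (q.2 : ZMod 7) * h7
  rw [thetaGenTerm, ← hj, dualGaussTerm]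
  congr 2
  simp only [latticePt, normForm, residueEquiv, Equiv.coe_fn_mk, twistFst, twistSnd]
  push_cast
  field_simp
  ring_nf
  simp only [eta_sq, I_sq, show I ^ 3 = -I by rw [pow_succ, I_sq]; ring, I_pow_four]
  ring

theorem thetaGen_functional_equation {t : ℝ} (ht : 0 < t) (w : ℂ) :
    gauss7 * ∑' p, thetaGenTerm t w p = √7 / t * ∑' p, thetaGenTerm (1 / t) (I * w / t) p := by
  have hy : 0 < 2 * t / 7 := by positivity
  have hconst : (2 / (√7 * (2 * t / 7 : ℝ)) : ℂ) = √7 / t := by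
    have := sqrt_seven_ne_zero
    have htC : (t : ℂ) ≠ 0 := by exact_mod_cast ht.ne'
    push_cast
    field_simp
    exact sqrt_seven_sq.symm
  calc gauss7 * ∑' p, thetaGenTerm t w p
      = ∑' p, ∑ j, chi7 j * gaussTerm (2 * t / 7) (twistFst w j) (twistSnd w j) p := by
        rw [← tsum_mul_left, tsum_congr (gauss7_mul_thetaGenTerm t w)]
    _ = ∑ j, chi7 j * ∑' p, gaussTerm (2 * t / 7) (twistFst w j) (twistSnd w j) p := by
        rw [Summable.tsum_finsetSum fun j _ ↦ (summable_gaussTerm hy _ _).mul_left _]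
        simp only [tsum_mul_left]
    _ = √7 / t * ∑ j, ∑' q, thetaGenTerm (1 / t) (I * w / t) (residueEquiv (j, q)) := by
        rw [Finset.mul_sum]
        refine Finset.sum_congr rfl fun j _ ↦ ?_
        rw [tsum_gaussTerm hy, hconst, mul_left_comm, ← tsum_mul_left,
          tsum_congr (chi7_mul_dualGaussTerm ht w j)]
    _ = √7 / t * ∑' p, thetaGenTerm (1 / t) (I * w / t) p := by
        have hs := residueEquiv.summable_iff.mpr
          (summable_thetaGenTerm (one_div_pos.mpr ht) (I * w / t))
        rw [← residueEquiv.tsum_eq]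
        congr 1
        exact (hs.tsum_prod.trans (tsum_fintype _)).symm

lemma eq_of_forall_hasSum_pow_mul {𝕜 : Type*} [NontriviallyNormedField 𝕜] {a b : ℕ → 𝕜}
    {f : 𝕜 → 𝕜} (ha : ∀ w, HasSum (fun n ↦ w ^ n * a n) (f w))
    (hb : ∀ w, HasSum (fun n ↦ w ^ n * b n) (f w)) : a = b := by
  have key (c : ℕ → 𝕜) (hc : ∀ w, HasSum (fun n ↦ w ^ n * c n) (f w)) :
      HasFPowerSeriesAt f (FormalMultilinearSeries.ofScalars 𝕜 c) 0 := by
    rw [hasFPowerSeriesAt_iff]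
    refine Eventually.of_forall fun z ↦ ?_
    simpa [FormalMultilinearSeries.coeff_ofScalars] using hc z
  have h := (key a ha).eq_formalMultilinearSeries (key b hb)
  funext n
  simpa only [FormalMultilinearSeries.coeff_ofScalars] using
    congrArg (fun p : FormalMultilinearSeries 𝕜 𝕜 𝕜 ↦ p.coeff n) h

/-- The general term of the theta series with harmonic polynomial `α ^ k`. -/
noncomputable def thetaTerm (k : ℕ) (t : ℝ) (p : ℤ × ℤ) : ℂ :=
  eps p * latticePt p ^ k * (Real.exp (-(2 * π / 7 * normForm p) * t) : ℂ)

/-- The theta series of `ℤ[η]` with character `eps` and harmonic polynomial `α ^ k`. -/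
noncomputable def theta (k : ℕ) (t : ℝ) : ℂ := ∑' p, thetaTerm k t p

lemma thetaTerm_zero (k : ℕ) (t : ℝ) : thetaTerm k t 0 = 0 := by
  rw [thetaTerm, eps_zero, zero_mul, zero_mul]

lemma norm_thetaTerm_le (k : ℕ) (t : ℝ) (p : ℤ × ℤ) : ‖thetaTerm k t p‖ ≤
    Real.exp (-(2 * π / 7 * normForm p) * t) * ‖latticePt p‖ ^ k := by
  rw [thetaTerm, norm_mul, norm_mul, norm_pow, norm_real, Real.norm_of_nonneg (Real.exp_pos _).le,
    mul_comm]
  gcongr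
  exact mul_le_of_le_one_left (by positivity) (norm_eps_le_one p)

lemma hasSum_thetaGenTerm (t : ℝ) (w : ℂ) (p : ℤ × ℤ) :
    HasSum (fun k : ℕ ↦ w ^ k * (thetaTerm k t p / k.factorial)) (thetaGenTerm t w p) := by
  have h := (NormedSpace.expSeries_div_hasSum_exp (w * latticePt p)).mul_left
    (eps p * (Real.exp (-(2 * π / 7 * normForm p) * t) : ℂ))
  rw [← Complex.exp_eq_exp_ℂ, mul_assoc (eps p : ℂ), ofReal_exp, ← Complex.exp_add] at h
  convert! h using 1
  · funext k
    rw [thetaTerm, mul_pow, ofReal_exp]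
    ring
  · rw [thetaGenTerm]
    push_cast
    congr 2
    ring

lemma summable_exp_mul_exp_norm {t : ℝ} (ht : 0 < t) (r : ℝ) : Summable fun p : ℤ × ℤ ↦
    Real.exp (-(2 * π / 7 * normForm p) * t) * Real.exp (r * ‖latticePt p‖) := by
  refine (summable_exp_neg_normForm_add_norm (by positivity : 0 < 2 * π / 7 * t) r).congr
    fun p ↦ ?_
  congr 2
  ring

lemma summable_exp_mul_norm_pow {t : ℝ} (ht : 0 < t) (k : ℕ) : Summable fun p : ℤ × ℤ ↦
    Real.exp (-(2 * π / 7 * normForm p) * t) * ‖latticePt p‖ ^ k := by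
  refine Summable.of_nonneg_of_le (fun p ↦ by positivity) (fun p ↦ ?_)
    ((summable_exp_mul_exp_norm ht 1).mul_left (k.factorial : ℝ))
  have h := Real.pow_div_factorial_le_exp _ (norm_nonneg (latticePt p)) k
  rw [div_le_iff₀' (by positivity)] at h
  rw [mul_left_comm, one_mul]
  gcongr

lemma summable_thetaTerm {t : ℝ} (ht : 0 < t) (k : ℕ) : Summable (thetaTerm k t) :=
  (summable_exp_mul_norm_pow ht k).of_norm_bounded (norm_thetaTerm_le k t)

lemma hasSum_tsum_comm {α β E : Type*} [NormedAddCommGroup E] [CompleteSpace E] {F : α → β → E}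
    (hs : Summable fun x : α × β ↦ F x.1 x.2) :
    HasSum (fun b ↦ ∑' a, F a b) (∑' a, ∑' b, F a b) := by
  have hs' : Summable fun x : β × α ↦ F x.2 x.1 := (Equiv.prodComm β α).summable_iff.mpr hs
  rw [Summable.tsum_comm (f := fun b a ↦ F a b) hs']
  exact hs'.prod.hasSum

lemma summable_mul_pow_div_factorial {α : Type*} {f g : α → ℝ} (hf : ∀ a, 0 ≤ f a)
    (hg : ∀ a, 0 ≤ g a) (h : Summable fun a ↦ f a * Real.exp (g a)) :
    Summable fun x : α × ℕ ↦ f x.1 * (g x.1 ^ x.2 / x.2.factorial) := by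
  have hexp (x : ℝ) : HasSum (fun k : ℕ ↦ x ^ k / k.factorial) (Real.exp x) := by
    rw [Real.exp_eq_exp_ℝ]
    exact NormedSpace.expSeries_div_hasSum_exp x
  refine (summable_prod_of_nonneg fun x ↦ ?_).mpr
    ⟨fun p ↦ (hexp (g p)).summable.mul_left (f p), h.congr fun p ↦ ?_⟩
  · exact mul_nonneg (hf _) (div_nonneg (pow_nonneg (hg _) _) (Nat.cast_nonneg _))
  · dsimp only
    rw [tsum_mul_left, (hexp _).tsum_eq]

lemma hasSum_tsum_thetaGenTerm {t : ℝ} (ht : 0 < t) (w : ℂ) :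
    HasSum (fun k : ℕ ↦ w ^ k * (theta k t / k.factorial)) (∑' p, thetaGenTerm t w p) := by
  have hs : Summable fun x : (ℤ × ℤ) × ℕ ↦ w ^ x.2 * (thetaTerm x.2 t x.1 / x.2.factorial) := by
    have hb := summable_mul_pow_div_factorial (fun p : ℤ × ℤ ↦ (Real.exp_pos _).le)
      (fun p ↦ by positivity) (summable_exp_mul_exp_norm ht ‖w‖)
    refine hb.of_norm_bounded fun x ↦ ?_
    rw [norm_mul, norm_div, norm_pow, Complex.norm_natCast, mul_pow]
    calc ‖w‖ ^ x.2 * (‖thetaTerm x.2 t x.1‖ / x.2.factorial) ≤ ‖w‖ ^ x.2 *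
          (Real.exp (-(2 * π / 7 * normForm x.1) * t) * ‖latticePt x.1‖ ^ x.2 / x.2.factorial) := by
          gcongr
          exact norm_thetaTerm_le _ _ _
      _ = _ := by ring
  have h := hasSum_tsum_comm (F := fun p k ↦ w ^ k * (thetaTerm k t p / k.factorial)) hs
  simp only [fun p ↦ (hasSum_thetaGenTerm t w p).tsum_eq, tsum_mul_left, tsum_div_const] at h
  exact h

lemma gauss7_mul_theta (k : ℕ) {t : ℝ} (ht : 0 < t) :
    gauss7 * theta k t = √7 / t * (I / t) ^ k * theta k (1 / t) := by
  have h := eq_of_forall_hasSum_pow_mul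
    (a := fun k ↦ gauss7 * (theta k t / k.factorial))
    (b := fun k ↦ √7 / t * ((I / t) ^ k * (theta k (1 / t) / k.factorial)))
    (fun w ↦ by simpa only [mul_left_comm] using (hasSum_tsum_thetaGenTerm ht w).mul_left gauss7)
    (fun w ↦ by
      rw [thetaGen_functional_equation ht]
      refine ((hasSum_tsum_thetaGenTerm (one_div_pos.mpr ht) (I * w / t)).mul_left
        (√7 / t : ℂ)).congr_fun fun k ↦ ?_
      rw [mul_div_right_comm, mul_pow]; ring)
  have hk : gauss7 * (theta k t / k.factorial) =
      √7 / t * ((I / t) ^ k * (theta k (1 / t) / k.factorial)) := congrFun h k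
  have hf : (k.factorial : ℂ) ≠ 0 := by exact_mod_cast k.factorial_ne_zero
  field_simp at hk ⊢
  linear_combination hk

/-- The root number in the functional equation of `theta k`. -/
noncomputable def rootNumber (k : ℕ) : ℂ := gauss7 / √7 * (I ^ k)⁻¹

lemma norm_rootNumber (k : ℕ) : ‖rootNumber k‖ = 1 := by
  have : √7 ≠ 0 := by positivity
  rw [rootNumber, norm_mul, norm_div, norm_gauss7, norm_inv, norm_pow, norm_I, norm_real,
    Real.norm_of_nonneg (Real.sqrt_nonneg _), div_self this, one_pow, inv_one, mul_one]

theorem theta_functional_equation (k : ℕ) {t : ℝ} (ht : 0 < t) :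
    theta k (1 / t) = rootNumber k * (t : ℂ) ^ (k + 1) * theta k t := by
  have htC : (t : ℂ) ≠ 0 := by exact_mod_cast ht.ne'
  have h7 := sqrt_seven_ne_zero
  have hI : I ^ k ≠ 0 := pow_ne_zero _ I_ne_zero
  calc theta k (1 / t)
      = (I ^ k)⁻¹ / √7 * t ^ (k + 1) * (√7 / t * (I / t) ^ k * theta k (1 / t)) := by
        rw [div_pow]; field_simp; ring
    _ = rootNumber k * t ^ (k + 1) * theta k t := by
        rw [← gauss7_mul_theta k ht, rootNumber]; ring

lemma norm_thetaTerm_le_of_one_le {t : ℝ} (ht : 1 ≤ t) (k : ℕ) (p : ℤ × ℤ) : ‖thetaTerm k t p‖ ≤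
    Real.exp (-(π / 7) * t) *
      (Real.exp (-(2 * π / 7 * normForm p) * (1 / 2)) * ‖latticePt p‖ ^ k) := by
  rcases eq_or_ne p 0 with rfl | hp
  · rw [thetaTerm_zero, norm_zero]; positivity
  refine (norm_thetaTerm_le k t p).trans ?_
  rw [← mul_assoc, ← Real.exp_add]
  gcongr
  have : (1 : ℝ) ≤ normForm p := by exact_mod_cast normForm_pos hp
  have h2 : t + normForm p ≤ 2 * normForm p * t := by nlinarith
  nlinarith [mul_le_mul_of_nonneg_left h2 (by positivity : 0 ≤ π / 7)]

lemma continuousOn_theta (k : ℕ) : ContinuousOn (theta k) (Ioi 0) := by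
  intro t ht
  have h : ContinuousOn (theta k) (Ici (t / 2)) := by
    refine continuousOn_tsum (fun p ↦ ?_) (summable_exp_mul_norm_pow (half_pos ht) k)
      fun p x hx ↦ ?_
    · unfold thetaTerm; fun_prop
    · refine (norm_thetaTerm_le k x p).trans ?_
      have : (0 : ℝ) ≤ normForm p := by exact_mod_cast normForm_nonneg p
      rw [neg_mul, neg_mul]
      gcongr
      exact hx
  exact (h.continuousAt (Ici_mem_nhds (half_lt_self ht))).continuousWithinAt

lemma theta_isBigO_rpow (k : ℕ) (r : ℝ) : theta k =O[atTop] (· ^ r) := by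
  refine Asymptotics.IsBigO.trans ?_ (isLittleO_exp_neg_mul_rpow_atTop
    (by positivity : 0 < π / 7) r).isBigO
  refine Asymptotics.IsBigO.of_bound (∑' p : ℤ × ℤ,
    Real.exp (-(2 * π / 7 * normForm p) * (1 / 2)) * ‖latticePt p‖ ^ k) ?_
  filter_upwards [eventually_ge_atTop 1] with t ht
  have hs := summable_exp_mul_norm_pow (by norm_num : (0 : ℝ) < 1 / 2) k
  rw [Real.norm_of_nonneg (Real.exp_pos _).le, mul_comm, ← tsum_mul_left]
  exact tsum_of_norm_bounded (hs.mul_left _).hasSum (norm_thetaTerm_le_of_one_le ht k)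

/-- The functional-equation pair attached to `theta k`, from which the analytic continuation of its
Mellin transform is obtained. -/
noncomputable def thetaFEPair (k : ℕ) : WeakFEPair ℂ where
  f := theta k
  g := theta k
  k := k + 1
  ε := rootNumber k
  f₀ := 0
  g₀ := 0
  hf_int := (continuousOn_theta k).locallyIntegrableOn measurableSet_Ioi
  hg_int := (continuousOn_theta k).locallyIntegrableOn measurableSet_Ioi
  hk := by positivity
  hε := by
    rw [← norm_pos_iff, norm_rootNumber]; exact one_pos
  h_feq x hx := by
    rw [theta_functional_equation k hx, smul_eq_mul]
    norm_cast
  hf_top r := by simpa using theta_isBigO_rpow k r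
  hg_top r := by simpa using theta_isBigO_rpow k r

lemma isStrongFEPair_thetaFEPair (k : ℕ) : IsStrongFEPair (thetaFEPair k) := ⟨rfl, rfl⟩

lemma differentiable_mellin_theta (k : ℕ) : Differentiable ℂ (mellin (theta k)) := by
  have h := (isStrongFEPair_thetaFEPair k).differentiable_Λ
  rwa [(isStrongFEPair_thetaFEPair k).Λ_eq] at h

lemma mellinConvergent_theta (k : ℕ) (s : ℂ) : MellinConvergent (theta k) s :=
  ((isStrongFEPair_thetaFEPair k).hasMellin s).1

lemma norm_sq_div_two_le_normForm (x : Fin 2 → ℤ) : ‖x‖ ^ 2 / 2 ≤ normForm (x 0, x 1) := by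
  refine le_trans ?_ (half_sq_add_sq_le_normForm _)
  gcongr
  rw [EisensteinSeries.norm_eq_max_natAbs]
  rcases max_choice (x 0).natAbs (x 1).natAbs with h | h <;> rw [h, Nat.cast_natAbs, Int.cast_abs,
    sq_abs] <;> nlinarith [sq_nonneg (x 0 : ℝ), sq_nonneg (x 1 : ℝ)]

lemma summable_normForm_rpow {σ : ℝ} (hσ : 1 < σ) :
    Summable fun p : ℤ × ℤ ↦ (normForm p : ℝ) ^ (-σ) := by
  rw [← (finTwoArrowEquiv ℤ).summable_iff]
  refine ((EisensteinSeries.summable_one_div_norm_rpow (k := 2 * σ) (by linarith)).mul_left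
    (2 ^ σ)).of_nonneg_of_le (fun x ↦ ?_) (fun x ↦ ?_)
  · exact Real.rpow_nonneg (by exact_mod_cast normForm_nonneg _) _
  rcases eq_or_ne x 0 with rfl | hx
  · rw [norm_zero, Real.zero_rpow (by linarith), mul_zero]
    simp [normForm, Real.zero_rpow (by linarith : -σ ≠ 0)]
  have hpos : 0 < ‖x‖ := norm_pos_iff.mpr hx
  calc (normForm (x 0, x 1) : ℝ) ^ (-σ) ≤ (‖x‖ ^ 2 / 2) ^ (-σ) :=
        Real.rpow_le_rpow_of_nonpos (by positivity) (norm_sq_div_two_le_normForm x) (by linarith)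
    _ = 2 ^ σ * ‖x‖ ^ (-(2 * σ)) := by
        rw [Real.div_rpow (by positivity) zero_le_two, Real.rpow_neg zero_le_two,
          ← Real.rpow_natCast, ← Real.rpow_mul hpos.le, div_inv_eq_mul, mul_comm, Nat.cast_two,
          mul_neg]

lemma norm_eps_mul_latticePt_pow_div_le (k : ℕ) (σ : ℝ) {p : ℤ × ℤ} (hp : p ≠ 0) :
    ‖(eps p : ℂ) * latticePt p ^ k‖ / (normForm p : ℝ) ^ (σ + k / 2) ≤
      (normForm p : ℝ) ^ (-σ) := by
  have hN : (0 : ℝ) < normForm p := by exact_mod_cast normForm_pos hp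
  have hk : ‖latticePt p‖ ^ k = (normForm p : ℝ) ^ ((k : ℝ) / 2) := by
    rw [norm_latticePt, Real.sqrt_eq_rpow, ← Real.rpow_natCast, ← Real.rpow_mul hN.le]
    congr 1; ring
  rw [div_le_iff₀ (by positivity), ← Real.rpow_add hN, neg_add_cancel_left, norm_mul, norm_pow, hk]
  exact mul_le_of_le_one_left (by positivity) (norm_eps_le_one p)

lemma add_natCast_div_two_re (s : ℂ) (k : ℕ) : (s + k / 2).re = s.re + k / 2 := by
  rw [add_re, ← ofReal_natCast, ← ofReal_ofNat, ← ofReal_div, ofReal_re]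

lemma hasSum_mellin_theta (k : ℕ) {s : ℂ} (hs : 1 < s.re) :
    HasSum (fun p : {p : ℤ × ℤ // p ≠ 0} ↦ Gamma (s + k / 2) * (eps p * latticePt p ^ k) /
      ((2 * π / 7 * normForm p : ℝ) : ℂ) ^ (s + k / 2)) (mellin (theta k) (s + k / 2)) := by
  have hN (p : {p : ℤ × ℤ // p ≠ 0}) : (0 : ℝ) < normForm p := by exact_mod_cast normForm_pos p.2
  refine hasSum_mellin (a := fun p : {p : ℤ × ℤ // p ≠ 0} ↦ (eps p : ℂ) * latticePt p ^ k)
    (p := fun p ↦ 2 * π / 7 * normForm p) (fun p ↦ Or.inr (by have := hN p; positivity)) ?_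
    (fun t ht ↦ ?_) ?_
  · rw [add_natCast_div_two_re]; positivity
  · refine (hasSum_subtype_iff_of_support_subset (s := {p | p ≠ 0}) fun p hp h0 ↦ hp ?_).mpr
      (summable_thetaTerm ht k).hasSum
    rw [h0, thetaTerm_zero]
  · refine (((summable_normForm_rpow hs).subtype {p | p ≠ 0}).mul_left
      (((2 * π / 7) ^ (s.re + k / 2) : ℝ)⁻¹)).of_nonneg_of_le (fun p ↦ ?_) fun p ↦ ?_
    · have := hN p; positivity
    · rw [add_natCast_div_two_re, Real.mul_rpow (by positivity) (hN p).le, ← div_div,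
        div_right_comm, div_eq_inv_mul]
      gcongr
      exact norm_eps_mul_latticePt_pow_div_le k s.re p.2

/-- The continuation of the Hecke series, as a Mellin transform of the theta series. -/
noncomputable def heckeMellin (k : ℕ) (s : ℂ) : ℂ :=
  1 / 2 * (((2 * π / 7 : ℝ) : ℂ) ^ (s + k / 2) * ((Gamma (s + k / 2))⁻¹ *
    mellin (theta k) (s + k / 2)))

lemma two_pi_div_seven_ne_zero : ((2 * π / 7 : ℝ) : ℂ) ≠ 0 := by
  exact_mod_cast (by positivity : (0 : ℝ) < 2 * π / 7).ne'

lemma differentiable_heckeMellin (k : ℕ) : Differentiable ℂ (heckeMellin k) := by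
  have h : Differentiable ℂ fun s : ℂ ↦ s + k / 2 := by fun_prop
  refine Differentiable.const_mul (Differentiable.mul ?_ (Differentiable.mul ?_ ?_)) _
  · exact h.const_cpow (Or.inl two_pi_div_seven_ne_zero)
  · exact differentiable_one_div_Gamma.comp h
  · exact (differentiable_mellin_theta k).comp h

lemma hasSum_heckeTerm {k : ℕ} (hk : Odd k) {s : ℂ} (hs : 1 < s.re) :
    HasSum (fun p : {p : ℤ × ℤ // p ≠ 0} ↦ heckeTerm k s p) (heckeMellin k s) := by
  have h := ((hasSum_mellin_theta k hs).mul_left (Gamma (s + k / 2))⁻¹).mul_left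
    (((2 * π / 7 : ℝ) : ℂ) ^ (s + k / 2)) |>.mul_left (1 / 2)
  refine h.congr_fun fun p ↦ ?_
  have hN : (0 : ℝ) ≤ normForm p := by exact_mod_cast normForm_nonneg p
  have hΓ : Gamma (s + k / 2) ≠ 0 :=
    Gamma_ne_zero_of_re_pos (by rw [add_natCast_div_two_re]; positivity)
  have hc : ((2 * π / 7 : ℝ) : ℂ) ^ (s + k / 2) ≠ 0 :=
    cpow_ne_zero_iff.mpr (Or.inl two_pi_div_seven_ne_zero)
  rw [heckeTerm, heckeChi, mul_pow, eps_pow_odd _ hk, ofReal_mul,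
    mul_cpow_ofReal_nonneg (by positivity) hN, ofReal_intCast, ← latticePt, mul_div_assoc (Gamma _),
    inv_mul_cancel_left₀ hΓ, mul_comm (((2 * π / 7 : ℝ) : ℂ) ^ _) ((normForm p : ℂ) ^ _), ← div_div,
    mul_div_cancel₀ _ hc]

lemma isHeckeL_heckeMellin {k : ℕ} (hk : Odd k) : IsHeckeL k (heckeMellin k) :=
  ⟨differentiable_heckeMellin k, fun _ hs ↦ hasSum_heckeTerm hk hs⟩

lemma IsHeckeL.eq {k : ℕ} {F G : ℂ → ℂ} (hF : IsHeckeL k F) (hG : IsHeckeL k G) : F = G := by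
  have hFa : AnalyticOnNhd ℂ F univ := hF.1.differentiableOn.analyticOnNhd isOpen_univ
  have hGa : AnalyticOnNhd ℂ G univ := hG.1.differentiableOn.analyticOnNhd isOpen_univ
  refine hFa.eq_of_eventuallyEq hGa (z₀ := 2) ?_
  filter_upwards [(isOpen_lt continuous_const continuous_re).mem_nhds
    (show (1 : ℝ) < (2 : ℂ).re by norm_num)] with s hs
  exact (hF.2 s hs).unique (hG.2 s hs)

lemma isHeckeL_heckeL {k : ℕ} (hk : Odd k) : IsHeckeL k (heckeL k) := by
  have h : ∃ F : ℂ → ℂ, IsHeckeL k F := ⟨_, isHeckeL_heckeMellin hk⟩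
  rw [heckeL, dif_pos h]
  exact h.choose_spec

lemma heckeL_eq_heckeMellin {k : ℕ} (hk : Odd k) : heckeL k = heckeMellin k :=
  (isHeckeL_heckeL hk).eq (isHeckeL_heckeMellin hk)

/-- The probability that a Poisson variable of mean `y` is less than `r`. As the regularised
incomplete gamma function `Γ(r, y) / Γ(r)` it is the weight of the approximate functional
equation. -/
noncomputable def poissonTail (r : ℕ) (y : ℝ) : ℝ :=
  Real.exp (-y) * ∑ j ∈ Finset.range r, y ^ j / j.factorial

lemma poissonTail_nonneg (r : ℕ) {y : ℝ} (hy : 0 ≤ y) : 0 ≤ poissonTail r y :=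
  mul_nonneg (Real.exp_pos _).le (Finset.sum_nonneg fun _ _ ↦ by positivity)

lemma poissonTail_le_one (r : ℕ) {y : ℝ} (hy : 0 ≤ y) : poissonTail r y ≤ 1 := by
  rw [poissonTail, Real.exp_neg, inv_mul_le_iff₀ (Real.exp_pos _), mul_one]
  exact Real.sum_le_exp_of_nonneg hy r

lemma poissonTail_mono {y : ℝ} (hy : 0 ≤ y) : Monotone fun r ↦ poissonTail r y := by
  intro r s hrs
  refine mul_le_mul_of_nonneg_left ?_ (Real.exp_pos _).le
  exact Finset.sum_le_sum_of_subset_of_nonneg (Finset.range_mono hrs) fun _ _ _ ↦ by positivity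

lemma poissonTail_le (r : ℕ) {y : ℝ} (hy : 0 ≤ y) :
    poissonTail r y ≤ 2 ^ r * Real.exp (-(y / 2)) := by
  have h : ∑ j ∈ Finset.range r, y ^ j / j.factorial ≤ 2 ^ r * Real.exp (y / 2) := by
    calc ∑ j ∈ Finset.range r, y ^ j / j.factorial
        ≤ ∑ j ∈ Finset.range r, 2 ^ r * ((y / 2) ^ j / j.factorial) := by
          refine Finset.sum_le_sum fun j hj ↦ ?_
          have : (2 : ℝ) ^ j ≤ 2 ^ r :=
            pow_le_pow_right₀ (by norm_num) (Finset.mem_range.mp hj).le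
          calc y ^ j / j.factorial = 2 ^ j * ((y / 2) ^ j / j.factorial) := by
                rw [div_pow]; field_simp
            _ ≤ _ := by gcongr
      _ ≤ _ := by
          rw [← Finset.mul_sum]
          gcongr
          exact Real.sum_le_exp_of_nonneg (by positivity) r
  calc poissonTail r y ≤ Real.exp (-y) * (2 ^ r * Real.exp (y / 2)) := by
        unfold poissonTail; gcongr
    _ = 2 ^ r * Real.exp (-(y / 2)) := by
        rw [mul_left_comm, ← Real.exp_add]; congr 2; ring

lemma poissonTail_le_of_le {r : ℕ} {y : ℝ} (hy : 4 * (r : ℝ) ≤ y) :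
    poissonTail r y ≤ Real.exp (-(y / 4)) := by
  refine (poissonTail_le r (by linarith [r.cast_nonneg (α := ℝ)])).trans ?_
  have h2 : (2 : ℝ) ^ r ≤ Real.exp r := by
    rw [← Real.exp_one_pow r]
    gcongr
    linarith [Real.add_one_le_exp 1]
  calc (2 : ℝ) ^ r * Real.exp (-(y / 2)) ≤ Real.exp r * Real.exp (-(y / 2)) := by gcongr
    _ ≤ _ := by rw [← Real.exp_add, Real.exp_le_exp]; linarith

lemma hasDerivAt_poissonTail (r : ℕ) (y : ℝ) :
    HasDerivAt (poissonTail (r + 1)) (-(Real.exp (-y) * y ^ r / r.factorial)) y := by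
  have he : HasDerivAt (fun y : ℝ ↦ Real.exp (-y)) (-Real.exp (-y)) y := by
    simpa using (hasDerivAt_neg y).exp
  induction r with
  | zero =>
    have h : poissonTail (0 + 1) = fun y ↦ Real.exp (-y) := by funext y; simp [poissonTail]
    rw [h]
    simpa using he
  | succ r ih =>
    have h : poissonTail (r + 1 + 1) = fun y ↦ poissonTail (r + 1) y +
        Real.exp (-y) * (y ^ (r + 1) / (r + 1).factorial) := by
      funext y
      rw [poissonTail, Finset.sum_range_succ, mul_add, poissonTail]
    rw [h]
    have := ih.add (he.mul ((hasDerivAt_pow (r + 1) y).div_const ((r + 1).factorial : ℝ)))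
    refine this.congr_deriv ?_
    rw [Nat.factorial_succ]
    push_cast
    have : ((r : ℝ) + 1) ≠ 0 := by positivity
    simp only [neg_mul]
    field_simp
    ring

lemma poissonTail_antitoneOn (r : ℕ) : AntitoneOn (poissonTail (r + 1)) (Ici 0) := by
  refine antitoneOn_of_deriv_nonpos (convex_Ici 0)
    (fun y _ ↦ (hasDerivAt_poissonTail r y).continuousAt.continuousWithinAt)
    (fun y _ ↦ (hasDerivAt_poissonTail r y).differentiableAt.differentiableWithinAt) fun y hy ↦ ?_
  rw [interior_Ici, mem_Ioi] at hy
  rw [(hasDerivAt_poissonTail r y).deriv, neg_nonpos]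
  positivity

lemma tendsto_poissonTail (r : ℕ) : Tendsto (poissonTail r) atTop (𝓝 0) := by
  have h : Tendsto (fun y : ℝ ↦ 2 ^ r * Real.exp (-(y / 2))) atTop (𝓝 0) := by
    rw [← mul_zero ((2 : ℝ) ^ r)]
    refine Tendsto.const_mul _ (Real.tendsto_exp_neg_atTop_nhds_zero.comp ?_)
    exact tendsto_id.atTop_div_const (by norm_num)
  refine squeeze_zero' ?_ ?_ h
  · filter_upwards [eventually_ge_atTop 0] with y hy using poissonTail_nonneg r hy
  · filter_upwards [eventually_ge_atTop 0] with y hy using poissonTail_le r hy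

lemma integral_Ioi_one_pow_mul_exp (m : ℕ) {x : ℝ} (hx : 0 < x) :
    IntegrableOn (fun t : ℝ ↦ t ^ m * Real.exp (-x * t)) (Ioi 1) ∧
    ∫ t in Ioi (1 : ℝ), t ^ m * Real.exp (-x * t) =
      m.factorial / x ^ (m + 1) * poissonTail (m + 1) x := by
  have hd (t : ℝ) : HasDerivAt (fun t ↦ -(m.factorial / x ^ (m + 1)) * poissonTail (m + 1) (x * t))
      (t ^ m * Real.exp (-x * t)) t := by
    have h1 : HasDerivAt (fun t : ℝ ↦ x * t) x t := by simpa using (hasDerivAt_id t).const_mul x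
    have := ((hasDerivAt_poissonTail m (x * t)).comp t h1).const_mul (-(m.factorial / x ^ (m + 1)))
    refine this.congr_deriv ?_
    rw [mul_pow, neg_mul x t]
    field_simp
    ring
  have hpos : ∀ t ∈ Ioi (1 : ℝ), 0 ≤ t ^ m * Real.exp (-x * t) := fun t ht ↦ by
    have : (0 : ℝ) < t := one_pos.trans ht
    positivity
  have hlim : Tendsto (fun t ↦ -(m.factorial / x ^ (m + 1)) * poissonTail (m + 1) (x * t)) atTop
      (𝓝 0) := by
    rw [← mul_zero (-(m.factorial / x ^ (m + 1)) : ℝ)]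
    exact ((tendsto_poissonTail _).comp (tendsto_id.const_mul_atTop hx)).const_mul _
  refine ⟨integrableOn_Ioi_deriv_of_nonneg' (fun t _ ↦ hd t) hpos hlim, ?_⟩
  rw [integral_Ioi_of_hasDerivAt_of_nonneg' (fun t _ ↦ hd t) hpos hlim]
  simp

lemma mellin_indicator {E : Type*} [NormedAddCommGroup E] [NormedSpace ℂ E] (f : ℝ → E) (s : ℂ)
    {S : Set ℝ} (hS : MeasurableSet S) (hS0 : S ⊆ Ioi 0) :
    mellin (S.indicator f) s = ∫ t in S, (t : ℂ) ^ (s - 1) • f t := by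
  simp only [mellin, ← indicator_smul_apply (s := S) (fun t : ℝ ↦ (t : ℂ) ^ (s - 1))]
  rw [setIntegral_indicator hS, inter_eq_right.mpr hS0]

lemma mellin_eq_integral_Ioi_one_add {f : ℝ → ℂ} {ε κ s : ℂ}
    (hf : ∀ t : ℝ, 0 < t → f (1 / t) = ε * (t : ℂ) ^ κ * f t) (hs : MellinConvergent f s) :
    mellin f s = (∫ t in Ioi (1 : ℝ), (t : ℂ) ^ (s - 1) * f t) +
      ε * ∫ t in Ioi (1 : ℝ), (t : ℂ) ^ (κ - s - 1) * f t := by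
  have hind : (Ioc 0 1).indicator f =
      fun t ↦ (Ici 1).indicator (fun t : ℝ ↦ ε * (t : ℂ) ^ κ * f t) t⁻¹ := by
    funext t
    by_cases ht : t ∈ Ioc (0 : ℝ) 1
    · rw [indicator_of_mem ht, indicator_of_mem (mem_Ici.mpr (one_le_inv_iff₀.mpr ht)),
        ← hf _ (inv_pos.mpr ht.1), one_div, inv_inv]
    · have ht' : t⁻¹ ∉ Ici 1 := fun h ↦ ht (one_le_inv_iff₀.mp h)
      rw [indicator_of_notMem ht, indicator_of_notMem ht']
  have hsmall : ∫ t in Ioc (0 : ℝ) 1, (t : ℂ) ^ (s - 1) • f t =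
      ε * ∫ t in Ioi (1 : ℝ), (t : ℂ) ^ (κ - s - 1) * f t := by
    rw [← mellin_indicator f s measurableSet_Ioc Ioc_subset_Ioi_self, hind, mellin_comp_inv,
      mellin_indicator _ _ measurableSet_Ici (Ici_subset_Ioi.mpr one_pos),
      integral_Ici_eq_integral_Ioi, ← integral_const_mul]
    refine setIntegral_congr_fun measurableSet_Ioi fun t ht ↦ ?_
    have ht0 : (t : ℂ) ≠ 0 := by exact_mod_cast (one_pos.trans (mem_Ioi.mp ht)).ne'
    rw [show κ - s - 1 = (-s - 1) + κ by ring, cpow_add _ _ ht0, smul_eq_mul]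
    ring
  rw [mellin, ← Ioc_union_Ioi_eq_Ioi zero_le_one, setIntegral_union Ioc_disjoint_Ioi_same
    measurableSet_Ioi (hs.mono_set Ioc_subset_Ioi_self) (hs.mono_set (Ioi_subset_Ioi zero_le_one)),
    hsmall, add_comm]
  simp only [smul_eq_mul]

lemma mellin_theta_center (m : ℕ) : mellin (theta (2 * m + 1)) (m + 1) =
    (1 + rootNumber (2 * m + 1)) * ∫ t in Ioi (1 : ℝ), (t : ℂ) ^ m * theta (2 * m + 1) t := by
  have h := mellin_eq_integral_Ioi_one_add (κ := ((2 * m + 1 + 1 : ℕ) : ℂ))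
    (fun t ht ↦ by rw [cpow_natCast, theta_functional_equation (2 * m + 1) ht])
    (mellinConvergent_theta (2 * m + 1) (m + 1))
  have hκ : ((2 * m + 1 + 1 : ℕ) : ℂ) - (m + 1) - 1 = m := by push_cast; ring
  simp only [hκ, add_sub_cancel_right, cpow_natCast] at h
  rw [h, add_mul, one_mul]

/-- The coefficient `χ((a + b η)) ^ (2 m + 1) / N (a + b η) ^ (m + 1)` of the series of
`L(s, χ ^ (2 m + 1))` at `s = 1 / 2`; it is `0` at the origin. -/
noncomputable def centralCoeff (m : ℕ) (p : ℤ × ℤ) : ℂ :=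
  eps p * latticePt p ^ (2 * m + 1) / (normForm p : ℂ) ^ (m + 1)

/-- The general term of the approximate functional equation at `1 / 2` of `L(s, χ ^ (2 m + 1))`. -/
noncomputable def centralTerm (m : ℕ) (p : ℤ × ℤ) : ℂ :=
  centralCoeff m p * (poissonTail (m + 1) (2 * π / 7 * normForm p) : ℂ)

lemma two_pi_div_seven_mul_normForm_nonneg (p : ℤ × ℤ) : 0 ≤ 2 * π / 7 * normForm p :=
  mul_nonneg (by positivity) (by exact_mod_cast normForm_nonneg p)

lemma centralCoeff_zero (m : ℕ) : centralCoeff m 0 = 0 := by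
  rw [centralCoeff, eps_zero, zero_mul, zero_div]

lemma centralTerm_zero (m : ℕ) : centralTerm m 0 = 0 := by
  rw [centralTerm, centralCoeff_zero, zero_mul]

lemma norm_centralCoeff_le (m : ℕ) (p : ℤ × ℤ) : ‖centralCoeff m p‖ ≤ ‖latticePt p‖⁻¹ := by
  rcases eq_or_ne p 0 with rfl | hp
  · rw [centralCoeff_zero, norm_zero]; positivity
  have hα : 0 < ‖latticePt p‖ := one_pos.trans_le (one_le_norm_latticePt hp)
  have hN : ‖(normForm p : ℂ)‖ = ‖latticePt p‖ ^ 2 := by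
    rw [norm_latticePt_sq, norm_intCast, abs_of_nonneg (by exact_mod_cast normForm_nonneg p)]
  rw [centralCoeff, norm_div, norm_mul, norm_pow, norm_pow, hN, div_le_iff₀ (by positivity)]
  calc ‖(eps p : ℂ)‖ * ‖latticePt p‖ ^ (2 * m + 1) ≤ ‖latticePt p‖ ^ (2 * m + 1) :=
        mul_le_of_le_one_left (by positivity) (norm_eps_le_one p)
    _ = ‖latticePt p‖⁻¹ * (‖latticePt p‖ ^ 2) ^ (m + 1) := by field_simp; ring

lemma norm_centralTerm_le_mul_poissonTail (m : ℕ) (p : ℤ × ℤ) :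
    ‖centralTerm m p‖ ≤ ‖latticePt p‖⁻¹ * poissonTail (m + 1) (2 * π / 7 * normForm p) := by
  have hG := poissonTail_nonneg (m + 1) (two_pi_div_seven_mul_normForm_nonneg p)
  rw [centralTerm, norm_mul, norm_real, Real.norm_of_nonneg hG]
  gcongr
  exact norm_centralCoeff_le m p

lemma norm_centralTerm_le_poissonTail (m : ℕ) (p : ℤ × ℤ) :
    ‖centralTerm m p‖ ≤ poissonTail (m + 1) (2 * π / 7 * normForm p) := by
  have hG := poissonTail_nonneg (m + 1) (two_pi_div_seven_mul_normForm_nonneg p)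
  rcases eq_or_ne p 0 with rfl | hp
  · rwa [centralTerm_zero, norm_zero]
  exact (norm_centralTerm_le_mul_poissonTail m p).trans
    (mul_le_of_le_one_left hG (inv_le_one_of_one_le₀ (one_le_norm_latticePt hp)))

lemma norm_centralTerm_le_inv_norm (m : ℕ) (p : ℤ × ℤ) :
    ‖centralTerm m p‖ ≤ ‖latticePt p‖⁻¹ :=
  (norm_centralTerm_le_mul_poissonTail m p).trans (mul_le_of_le_one_right (by positivity)
    (poissonTail_le_one _ (two_pi_div_seven_mul_normForm_nonneg p)))

lemma summable_centralTerm (m : ℕ) : Summable (centralTerm m) := by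
  refine ((summable_exp_mul_norm_pow (by norm_num : (0 : ℝ) < 1 / 2) 0).mul_left
    (2 ^ (m + 1))).of_norm_bounded fun p ↦ ?_
  calc ‖centralTerm m p‖ ≤ poissonTail (m + 1) (2 * π / 7 * normForm p) :=
        norm_centralTerm_le_poissonTail m p
    _ ≤ 2 ^ (m + 1) * Real.exp (-(2 * π / 7 * normForm p / 2)) :=
        poissonTail_le _ (two_pi_div_seven_mul_normForm_nonneg p)
    _ = _ := by rw [pow_zero, mul_one]; congr 2; ring

lemma integral_norm_const_mul_ofReal {α : Type*} [MeasurableSpace α] {μ : Measure α} (z : ℂ)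
    {g : α → ℝ} (hg : 0 ≤ᵐ[μ] g) : ∫ x, ‖z * (g x : ℂ)‖ ∂μ = ‖∫ x, z * (g x : ℂ) ∂μ‖ := by
  rw [integral_const_mul, integral_complex_ofReal, norm_mul, norm_real,
    Real.norm_of_nonneg (integral_nonneg_of_ae hg), ← integral_const_mul]
  refine integral_congr_ae (hg.mono fun x hx ↦ ?_)
  dsimp only
  rw [norm_mul, norm_real, Real.norm_of_nonneg hx]

lemma pow_mul_thetaTerm (m : ℕ) (p : ℤ × ℤ) (t : ℝ) : (t : ℂ) ^ m * thetaTerm (2 * m + 1) t p =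
    (eps p * latticePt p ^ (2 * m + 1)) *
      ((t ^ m * Real.exp (-(2 * π / 7 * normForm p) * t) : ℝ) : ℂ) := by
  rw [thetaTerm, ofReal_mul, ofReal_pow]; ring

lemma integrableOn_pow_mul_thetaTerm (m : ℕ) (p : ℤ × ℤ) :
    IntegrableOn (fun t : ℝ ↦ (t : ℂ) ^ m * thetaTerm (2 * m + 1) t p) (Ioi 1) := by
  rcases eq_or_ne p 0 with rfl | hp
  · simp only [thetaTerm_zero, mul_zero, integrableOn_zero]
  have hN : (0 : ℝ) < normForm p := by exact_mod_cast normForm_pos hp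
  simp only [pow_mul_thetaTerm]
  exact ((integral_Ioi_one_pow_mul_exp m (by positivity)).1.ofReal).const_mul _

lemma integral_pow_mul_thetaTerm (m : ℕ) (p : ℤ × ℤ) :
    ∫ t in Ioi (1 : ℝ), (t : ℂ) ^ m * thetaTerm (2 * m + 1) t p =
      m.factorial / (2 * π / 7 : ℝ) ^ (m + 1) * centralTerm m p := by
  rcases eq_or_ne p 0 with rfl | hp
  · simp only [thetaTerm_zero, mul_zero, integral_zero, centralTerm_zero]
  have hN : (0 : ℝ) < normForm p := by exact_mod_cast normForm_pos hp
  simp only [pow_mul_thetaTerm]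
  rw [integral_const_mul, integral_complex_ofReal,
    (integral_Ioi_one_pow_mul_exp m (by positivity)).2, centralTerm, centralCoeff]
  push_cast
  rw [mul_pow]
  field_simp

lemma integral_norm_pow_mul_thetaTerm (m : ℕ) (p : ℤ × ℤ) :
    ∫ t in Ioi (1 : ℝ), ‖(t : ℂ) ^ m * thetaTerm (2 * m + 1) t p‖ =
      ‖(m.factorial / (2 * π / 7 : ℝ) ^ (m + 1) : ℂ)‖ * ‖centralTerm m p‖ := by
  rw [← norm_mul, ← integral_pow_mul_thetaTerm]
  simp only [pow_mul_thetaTerm]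
  refine integral_norm_const_mul_ofReal _ ?_
  filter_upwards [self_mem_ae_restrict measurableSet_Ioi] with t ht
  have : 0 < t := one_pos.trans ht
  exact mul_nonneg (by positivity) (Real.exp_pos _).le

lemma integral_Ioi_one_theta (m : ℕ) :
    ∫ t in Ioi (1 : ℝ), (t : ℂ) ^ m * theta (2 * m + 1) t =
      m.factorial / (2 * π / 7 : ℝ) ^ (m + 1) * ∑' p, centralTerm m p := by
  have h := hasSum_integral_of_summable_integral_norm (integrableOn_pow_mul_thetaTerm m) (by
    simp only [integral_norm_pow_mul_thetaTerm]
    exact (summable_centralTerm m).norm.mul_left _)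
  simp only [integral_pow_mul_thetaTerm, tsum_mul_left] at h
  exact h.unique ((summable_centralTerm m).hasSum.mul_left _)

lemma heckeL_center (m : ℕ) : heckeL (2 * m + 1) (1 / 2) =
    1 / 2 * (1 + rootNumber (2 * m + 1)) * ∑' p, centralTerm m p := by
  have hs : (1 / 2 + ((2 * m + 1 : ℕ) : ℂ) / 2) = m + 1 := by push_cast; ring
  have hc := two_pi_div_seven_ne_zero
  have hf : (m.factorial : ℂ) ≠ 0 := by exact_mod_cast m.factorial_ne_zero
  rw [heckeL_eq_heckeMellin ⟨m, rfl⟩, heckeMellin, hs, mellin_theta_center, integral_Ioi_one_theta,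
    Gamma_nat_eq_factorial, ← Nat.cast_succ, cpow_natCast]
  field_simp

lemma norm_heckeL_center_le (m : ℕ) :
    ‖heckeL (2 * m + 1) (1 / 2)‖ ≤ ‖∑' p, centralTerm m p‖ := by
  rw [heckeL_center, norm_mul]
  refine mul_le_of_le_one_left (norm_nonneg _) ?_
  have := norm_add_le 1 (rootNumber (2 * m + 1))
  rw [norm_rootNumber, norm_one] at this
  rw [norm_mul, norm_div, norm_one, Complex.norm_two]
  linarith

/-- The sup norm of a lattice point, which makes counting by shells exact. -/
def supNat (p : ℤ × ℤ) : ℕ := max p.1.natAbs p.2.natAbs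

/-- The lattice points of sup norm at most `R`, over which the central series is truncated. -/
noncomputable def latticeBox (R : ℕ) : Finset (ℤ × ℤ) :=
  Finset.Icc (-R : ℤ) R ×ˢ Finset.Icc (-R : ℤ) R

lemma mem_latticeBox {R : ℕ} {p : ℤ × ℤ} : p ∈ latticeBox R ↔ supNat p ≤ R := by
  simp only [latticeBox, Finset.mem_product, Finset.mem_Icc, supNat]
  omega

lemma supNat_zero : supNat 0 = 0 := rfl

lemma supNat_pos {p : ℤ × ℤ} (hp : p ≠ 0) : 0 < supNat p := by
  contrapose! hp
  simp only [supNat] at hp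
  ext <;> simp only [Prod.fst_zero, Prod.snd_zero] <;> omega

lemma supNat_smul (j : ℤ) (p : ℤ × ℤ) : supNat (j • p) = j.natAbs * supNat p := by
  simp only [supNat, Prod.smul_fst, Prod.smul_snd, smul_eq_mul, Int.natAbs_mul]
  rw [mul_max_of_nonneg _ _ (Nat.zero_le _)]

lemma supNat_swap (p : ℤ × ℤ) : supNat p.swap = supNat p :=
  max_comm _ _

lemma supNat_sq_div_two_le_normForm (p : ℤ × ℤ) : (supNat p : ℝ) ^ 2 / 2 ≤ normForm p := by
  refine le_trans ?_ (half_sq_add_sq_le_normForm p)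
  gcongr
  rcases max_choice p.1.natAbs p.2.natAbs with h | h <;>
    simp [supNat, h, Nat.cast_natAbs, Int.cast_abs, sq_nonneg]

lemma inv_normForm_le (p : ℤ × ℤ) : (normForm p : ℝ)⁻¹ ≤ 2 * ((supNat p : ℝ) ^ 2)⁻¹ := by
  rcases eq_or_ne p 0 with rfl | hp
  · simp [normForm, supNat_zero]
  have hs : (0 : ℝ) < supNat p := by exact_mod_cast supNat_pos hp
  calc (normForm p : ℝ)⁻¹ ≤ ((supNat p : ℝ) ^ 2 / 2)⁻¹ := by
        gcongr; exact supNat_sq_div_two_le_normForm p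
    _ = 2 * ((supNat p : ℝ) ^ 2)⁻¹ := by rw [inv_div]; ring

lemma inv_norm_latticePt_le (p : ℤ × ℤ) : ‖latticePt p‖⁻¹ ≤ 2 * (supNat p : ℝ)⁻¹ := by
  refine le_of_sq_le_sq ?_ (by positivity)
  have h := inv_normForm_le p
  have hs : (0 : ℝ) ≤ ((supNat p : ℝ) ^ 2)⁻¹ := by positivity
  rw [inv_pow, norm_latticePt_sq, mul_pow, inv_pow]
  linarith

lemma sum_latticeBox_supNat {h : ℕ → ℝ} (h0 : h 0 = 0) (R : ℕ) :
    ∑ p ∈ latticeBox R, h (supNat p) = ∑ j ∈ Finset.range (R + 1), 8 * j * h j := by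
  rw [← Finset.sum_fiberwise_of_maps_to (g := supNat) (t := Finset.range (R + 1))
    fun p hp ↦ Finset.mem_range_succ_iff.mpr (mem_latticeBox.mp hp)]
  refine Finset.sum_congr rfl fun j hj ↦ ?_
  have hbox : (latticeBox R).filter (supNat · = j) = Finset.box j := by
    ext p
    rw [Finset.mem_filter, mem_latticeBox, Int.mem_box]
    exact and_iff_right_of_imp fun h ↦ (show supNat p = j from h).trans_le
      (Finset.mem_range_succ_iff.mp hj)
  rw [Finset.sum_congr hbox fun p hp ↦ by rw [show supNat p = j from Int.mem_box.mp hp],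
    Finset.sum_const, nsmul_eq_mul]
  rcases eq_or_ne j 0 with rfl | hj0
  · simp [h0]
  · rw [Int.card_box hj0]; push_cast; ring

lemma sum_range_succ_inv_le (R : ℕ) :
    ∑ j ∈ Finset.range (R + 1), (j : ℝ)⁻¹ ≤ 1 + Real.log R := by
  have h := harmonic_le_one_add_log R
  rw [harmonic] at h
  push_cast at h
  rw [Finset.sum_range_succ']
  simpa using h

lemma sum_latticeBox_inv_supNat (R : ℕ) :
    ∑ p ∈ latticeBox R, (supNat p : ℝ)⁻¹ = 8 * R := by
  rw [sum_latticeBox_supNat (h := fun j ↦ (j : ℝ)⁻¹) (by simp), Finset.sum_range_succ']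
  have h (j : ℕ) : 8 * ((j + 1 : ℕ) : ℝ) * ((j + 1 : ℕ) : ℝ)⁻¹ = 8 :=
    mul_inv_cancel_right₀ (by positivity) 8
  simp only [h, Finset.sum_const, Finset.card_range, nsmul_eq_mul, Nat.cast_zero, inv_zero,
    mul_zero, add_zero]
  ring

lemma sum_latticeBox_inv_supNat_sq_le (R : ℕ) :
    ∑ p ∈ latticeBox R, ((supNat p : ℝ) ^ 2)⁻¹ ≤ 8 * (1 + Real.log R) := by
  rw [sum_latticeBox_supNat (h := fun j ↦ ((j : ℝ) ^ 2)⁻¹) (by simp)]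
  have h (j : ℕ) : 8 * (j : ℝ) * ((j : ℝ) ^ 2)⁻¹ = 8 * (j : ℝ)⁻¹ := by
    rcases eq_or_ne j 0 with rfl | hj
    · simp
    · field_simp
  simp only [h, ← Finset.mul_sum]
  gcongr
  exact sum_range_succ_inv_le R

lemma sum_latticeBox_inv_norm_le (R : ℕ) : ∑ p ∈ latticeBox R, ‖latticePt p‖⁻¹ ≤ 16 * R := by
  calc ∑ p ∈ latticeBox R, ‖latticePt p‖⁻¹
      ≤ ∑ p ∈ latticeBox R, 2 * (supNat p : ℝ)⁻¹ :=
        Finset.sum_le_sum fun p _ ↦ inv_norm_latticePt_le p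
    _ = 16 * R := by rw [← Finset.mul_sum, sum_latticeBox_inv_supNat]; ring

lemma normForm_smul (j : ℤ) (p : ℤ × ℤ) : normForm (j • p) = j ^ 2 * normForm p := by
  simp only [normForm, Prod.smul_fst, Prod.smul_snd, smul_eq_mul]
  ring

/-- The primitive lattice point on the ray through `p` (the origin if `p = 0`). -/
def primitivePart (p : ℤ × ℤ) : ℤ × ℤ := (p.1 / Int.gcd p.1 p.2, p.2 / Int.gcd p.1 p.2)

lemma gcd_smul_primitivePart (p : ℤ × ℤ) : (Int.gcd p.1 p.2 : ℤ) • primitivePart p = p :=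
  Prod.ext (Int.mul_ediv_cancel' (Int.gcd_dvd_left _ _))
    (Int.mul_ediv_cancel' (Int.gcd_dvd_right _ _))

lemma gcd_pos_of_ne_zero {p : ℤ × ℤ} (hp : p ≠ 0) : 0 < Int.gcd p.1 p.2 := by
  rw [Int.gcd_pos_iff]
  contrapose! hp
  exact Prod.ext hp.1 hp.2

lemma isCoprime_primitivePart {p : ℤ × ℤ} (hp : p ≠ 0) :
    IsCoprime (primitivePart p).1 (primitivePart p).2 :=
  Int.isCoprime_iff_gcd_eq_one.mpr (Int.gcd_div_gcd_div_gcd (gcd_pos_of_ne_zero hp))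

lemma supNat_eq_gcd_mul (p : ℤ × ℤ) :
    supNat p = Int.gcd p.1 p.2 * supNat (primitivePart p) := by
  conv_lhs => rw [← gcd_smul_primitivePart p, supNat_smul, Int.natAbs_natCast]

lemma gcd_le_supNat (p : ℤ × ℤ) : Int.gcd p.1 p.2 ≤ supNat p := by
  rcases eq_or_ne p 0 with rfl | hp
  · simp
  rw [supNat_eq_gcd_mul]
  refine Nat.le_mul_of_pos_right _ (Nat.pos_of_ne_zero fun h ↦ ?_)
  exact (supNat_pos hp).ne' (by rw [supNat_eq_gcd_mul, h, mul_zero])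

lemma supNat_primitivePart_le (p : ℤ × ℤ) : supNat (primitivePart p) ≤ supNat p := by
  rcases eq_or_ne p 0 with rfl | hp
  · simp [primitivePart, supNat]
  rw [supNat_eq_gcd_mul p]
  exact Nat.le_mul_of_pos_left _ (gcd_pos_of_ne_zero hp)

lemma gcd_div_normForm_le (p : ℤ × ℤ) : (Int.gcd p.1 p.2 : ℝ) / normForm p ≤
    (Int.gcd p.1 p.2 : ℝ)⁻¹ * (2 * ((supNat (primitivePart p) : ℝ) ^ 2)⁻¹) := by
  rcases eq_or_ne p 0 with rfl | hp
  · simp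
  have hg : (Int.gcd p.1 p.2 : ℝ) ≠ 0 := by exact_mod_cast (gcd_pos_of_ne_zero hp).ne'
  have hN : (normForm p : ℝ) = (Int.gcd p.1 p.2 : ℝ) ^ 2 * normForm (primitivePart p) := by
    conv_lhs => rw [← gcd_smul_primitivePart p, normForm_smul]
    push_cast; rfl
  calc (Int.gcd p.1 p.2 : ℝ) / normForm p
      = (Int.gcd p.1 p.2 : ℝ)⁻¹ * (normForm (primitivePart p) : ℝ)⁻¹ := by
        rw [hN]; field_simp
    _ ≤ _ := by gcongr; exact inv_normForm_le _

lemma sum_gcd_div_normForm_le (R : ℕ) :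
    ∑ p ∈ latticeBox R, (Int.gcd p.1 p.2 : ℝ) / normForm p ≤ 16 * (1 + Real.log R) ^ 2 := by
  let split : ℤ × ℤ → ℕ × (ℤ × ℤ) := fun p ↦ (Int.gcd p.1 p.2, primitivePart p)
  let weight : ℕ × (ℤ × ℤ) → ℝ := fun x ↦ (x.1 : ℝ)⁻¹ * (2 * ((supNat x.2 : ℝ) ^ 2)⁻¹)
  have hinj : Function.Injective split := fun p q h ↦ by
    obtain ⟨hg, hb⟩ := Prod.mk.inj h
    rw [← gcd_smul_primitivePart p, hg, hb, gcd_smul_primitivePart]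
  have hmaps : ∀ p ∈ latticeBox R, split p ∈ Finset.range (R + 1) ×ˢ latticeBox R :=
    fun p hp ↦ Finset.mem_product.mpr
      ⟨Finset.mem_range_succ_iff.mpr ((gcd_le_supNat p).trans (mem_latticeBox.mp hp)),
        mem_latticeBox.mpr ((supNat_primitivePart_le p).trans (mem_latticeBox.mp hp))⟩
  calc ∑ p ∈ latticeBox R, (Int.gcd p.1 p.2 : ℝ) / normForm p
      ≤ ∑ p ∈ latticeBox R, weight (split p) :=
        Finset.sum_le_sum fun p _ ↦ gcd_div_normForm_le p
    _ = ∑ x ∈ (latticeBox R).image split, weight x := (Finset.sum_image hinj.injOn).symm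
    _ ≤ ∑ x ∈ Finset.range (R + 1) ×ˢ latticeBox R, weight x :=
        Finset.sum_le_sum_of_subset_of_nonneg (Finset.image_subset_iff.mpr hmaps)
          fun x _ _ ↦ by positivity
    _ = (∑ j ∈ Finset.range (R + 1), (j : ℝ)⁻¹) *
          (2 * ∑ p ∈ latticeBox R, ((supNat p : ℝ) ^ 2)⁻¹) := by
        rw [Finset.mul_sum, Finset.sum_mul_sum, Finset.sum_product]
    _ ≤ (1 + Real.log R) * (2 * (8 * (1 + Real.log R))) := by
        gcongr
        · exact sum_range_succ_inv_le R
        · exact sum_latticeBox_inv_supNat_sq_le R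
    _ = 16 * (1 + Real.log R) ^ 2 := by ring

/-- The determinant of two lattice points: it vanishes for parallel ones, and up to the factor
`-√7 / 2` it is the imaginary part of `p * conj q`. -/
def pairDet (p q : ℤ × ℤ) : ℤ := p.1 * q.2 - p.2 * q.1

lemma pairDet_smul_left (j : ℤ) (p q : ℤ × ℤ) : pairDet (j • p) q = j * pairDet p q := by
  simp only [pairDet, Prod.smul_fst, Prod.smul_snd, smul_eq_mul]
  ring

lemma pairDet_swap (p q : ℤ × ℤ) : pairDet p.swap q.swap = -pairDet p q := by
  simp only [pairDet, Prod.fst_swap, Prod.snd_swap]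
  ring

lemma natAbs_pairDet_le (p q : ℤ × ℤ) :
    (pairDet p q).natAbs ≤ 2 * (supNat p * supNat q) := by
  calc (pairDet p q).natAbs ≤ (p.1 * q.2).natAbs + (p.2 * q.1).natAbs := Int.natAbs_sub_le _ _
    _ = p.1.natAbs * q.2.natAbs + p.2.natAbs * q.1.natAbs := by simp only [Int.natAbs_mul]
    _ ≤ supNat p * supNat q + supNat p * supNat q := by
        gcongr <;> simp only [supNat, le_max_left, le_max_right]
    _ = _ := by ring

lemma card_le_div_add_one {T : Finset ℤ} {r L : ℕ} (hr : 0 < r)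
    (hL : ∀ x ∈ T, ∀ y ∈ T, x - y ≤ L) (hd : ∀ x ∈ T, ∀ y ∈ T, (r : ℤ) ∣ x - y) :
    T.card ≤ L / r + 1 := by
  rcases T.eq_empty_or_nonempty with rfl | hT
  · simp
  have hr' : (0 : ℤ) < r := by exact_mod_cast hr
  set a := T.min' hT
  have ha : a ∈ T := T.min'_mem hT
  have hcard : (Finset.Icc (0 : ℤ) (L / r : ℕ)).card = L / r + 1 := by
    rw [Int.card_Icc, sub_zero]
    exact Int.toNat_natCast _
  rw [← hcard]
  refine Finset.card_le_card_of_injOn (fun x ↦ (x - a) / r) (fun x hx ↦ ?_) fun x hx y hy h ↦ ?_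
  · refine Finset.mem_coe.mpr (Finset.mem_Icc.mpr ⟨?_, ?_⟩)
    · exact Int.ediv_nonneg (sub_nonneg.mpr (T.min'_le x hx)) hr'.le
    · push_cast
      exact Int.ediv_le_ediv hr' (hL x hx a ha)
  · have := (Int.ediv_left_inj (hd x hx a ha) (hd y hy a ha)).mp h
    omega

lemma card_filter_pairDet_eq_le_of_fst {R : ℕ} {b : ℤ × ℤ} (hb : IsCoprime b.1 b.2)
    (h0 : b.1 ≠ 0) (u : ℤ) :
    ((latticeBox R).filter (pairDet b · = u)).card ≤ 2 * R / b.1.natAbs + 1 := by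
  set S := (latticeBox R).filter (pairDet b · = u)
  have hbox {q : ℤ × ℤ} (hq : q ∈ S) : q.1 ∈ Finset.Icc (-R : ℤ) R :=
    (Finset.mem_product.mp (Finset.mem_filter.mp hq).1).1
  have hdet {q : ℤ × ℤ} (hq : q ∈ S) : b.1 * q.2 - b.2 * q.1 = u := (Finset.mem_filter.mp hq).2
  have hinj : Set.InjOn Prod.fst (S : Set (ℤ × ℤ)) := fun q hq q' hq' h ↦ by
    refine Prod.ext h (mul_left_cancel₀ h0 ?_)
    linear_combination hdet hq - hdet hq' + b.2 * h
  rw [← Finset.card_image_of_injOn hinj]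
  refine card_le_div_add_one (Int.natAbs_pos.mpr h0) ?_ ?_ <;>
    simp only [Finset.forall_mem_image]
  · intro q hq q' hq'
    have h := Finset.mem_Icc.mp (hbox hq)
    have h' := Finset.mem_Icc.mp (hbox hq')
    omega
  · intro q hq q' hq'
    rw [Int.natCast_natAbs, abs_dvd]
    refine hb.dvd_of_dvd_mul_left ⟨q.2 - q'.2, ?_⟩
    linear_combination hdet hq' - hdet hq

lemma card_filter_pairDet_eq_le {R : ℕ} {b : ℤ × ℤ} (hb : IsCoprime b.1 b.2) (u : ℤ) :
    ((latticeBox R).filter (pairDet b · = u)).card ≤ 2 * R / supNat b + 1 := by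
  have hpos : 0 < supNat b := supNat_pos fun h ↦ by
    rw [h] at hb; exact not_isCoprime_zero_zero hb
  rcases max_choice b.1.natAbs b.2.natAbs with h | h <;>
    rw [show supNat b = _ from h] at hpos ⊢
  · exact card_filter_pairDet_eq_le_of_fst hb (Int.natAbs_pos.mp hpos) u
  · refine le_trans ?_ (card_filter_pairDet_eq_le_of_fst (b := b.swap) hb.symm
      (Int.natAbs_pos.mp hpos) (-u))
    refine Finset.card_le_card_of_injOn Prod.swap (fun q hq ↦ ?_) Prod.swap_injective.injOn
    obtain ⟨hq, hdet⟩ := Finset.mem_filter.mp hq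
    refine Finset.mem_coe.mpr (Finset.mem_filter.mpr ⟨?_, ?_⟩)
    · rwa [mem_latticeBox, supNat_swap, ← mem_latticeBox]
    · rw [pairDet_swap, hdet]

lemma sum_Icc_neg_inv_abs_le (V : ℕ) :
    ∑ v ∈ Finset.Icc (-V : ℤ) V, |(v : ℝ)|⁻¹ ≤ 2 * (1 + Real.log V) := by
  rw [Finset.sum_Icc_of_even_eq_range (f := fun v : ℤ ↦ |(v : ℝ)|⁻¹) fun v ↦ by simp]
  simp only [Int.cast_natCast, Nat.abs_cast, Int.cast_zero, abs_zero, inv_zero, sub_zero,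
    two_nsmul, two_mul]
  gcongr <;> exact sum_range_succ_inv_le V

lemma sum_inv_abs_pairDet_le_of_isCoprime {R : ℕ} {b : ℤ × ℤ} (hb : IsCoprime b.1 b.2)
    (hbR : supNat b ≤ R) :
    ∑ q ∈ latticeBox R, |(pairDet b q : ℝ)|⁻¹ ≤
      (2 * R / supNat b + 1) * (2 * (1 + Real.log (2 * R ^ 2))) := by
  have hmaps : ∀ q ∈ latticeBox R,
      pairDet b q ∈ Finset.Icc (-(2 * R ^ 2 : ℕ) : ℤ) (2 * R ^ 2 : ℕ) := fun q hq ↦ by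
    have hdet : (pairDet b q).natAbs ≤ 2 * R ^ 2 := by
      rw [sq]
      exact (natAbs_pairDet_le b q).trans (by gcongr; exact mem_latticeBox.mp hq)
    rw [Finset.mem_Icc]
    omega
  rw [← Finset.sum_fiberwise_of_maps_to hmaps]
  calc ∑ u ∈ Finset.Icc (-(2 * R ^ 2 : ℕ) : ℤ) (2 * R ^ 2 : ℕ),
        ∑ q ∈ latticeBox R with pairDet b q = u, |(pairDet b q : ℝ)|⁻¹
      = ∑ u ∈ Finset.Icc (-(2 * R ^ 2 : ℕ) : ℤ) (2 * R ^ 2 : ℕ),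
          (((latticeBox R).filter (pairDet b · = u)).card : ℝ) * |(u : ℝ)|⁻¹ :=
        Finset.sum_congr rfl fun u _ ↦ by
          rw [Finset.sum_congr rfl fun q hq ↦ by rw [(Finset.mem_filter.mp hq).2],
            Finset.sum_const, nsmul_eq_mul]
    _ ≤ ∑ u ∈ Finset.Icc (-(2 * R ^ 2 : ℕ) : ℤ) (2 * R ^ 2 : ℕ),
          (2 * R / supNat b + 1) * |(u : ℝ)|⁻¹ := by
        gcongr with u
        calc (((latticeBox R).filter (pairDet b · = u)).card : ℝ)
            ≤ ((2 * R / supNat b + 1 : ℕ) : ℝ) := by exact_mod_cast card_filter_pairDet_eq_le hb u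
          _ ≤ 2 * R / supNat b + 1 := by
              have := Nat.cast_div_le (α := ℝ) (m := 2 * R) (n := supNat b)
              push_cast at this ⊢
              linarith
    _ ≤ (2 * R / supNat b + 1) * (2 * (1 + Real.log (2 * R ^ 2))) := by
        rw [← Finset.mul_sum]
        gcongr
        exact_mod_cast sum_Icc_neg_inv_abs_le (2 * R ^ 2)

lemma sum_inv_abs_pairDet_le {R : ℕ} {p : ℤ × ℤ} (hp : p ∈ latticeBox R) :
    ∑ q ∈ latticeBox R, |(pairDet p q : ℝ)|⁻¹ ≤
      6 * R * (1 + Real.log (2 * R ^ 2)) * (supNat p : ℝ)⁻¹ := by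
  rcases eq_or_ne p 0 with rfl | hp0
  · simp [pairDet, supNat_zero]
  set g := Int.gcd p.1 p.2
  set b := primitivePart p
  have hbR : supNat b ≤ R := (supNat_primitivePart_le p).trans (mem_latticeBox.mp hp)
  have hsup : supNat p = g * supNat b := supNat_eq_gcd_mul p
  have hb : (0 : ℝ) < supNat b := by
    exact_mod_cast Nat.pos_of_mul_pos_left (hsup ▸ supNat_pos hp0)
  have hbR' : (supNat b : ℝ) ≤ R := by exact_mod_cast hbR
  have hlog : 0 ≤ Real.log (2 * R ^ 2) := by exact_mod_cast Real.log_natCast_nonneg (2 * R ^ 2)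
  calc ∑ q ∈ latticeBox R, |(pairDet p q : ℝ)|⁻¹
      = (g : ℝ)⁻¹ * ∑ q ∈ latticeBox R, |(pairDet b q : ℝ)|⁻¹ := by
        rw [Finset.mul_sum]
        refine Finset.sum_congr rfl fun q _ ↦ ?_
        rw [← gcd_smul_primitivePart p, pairDet_smul_left, Int.cast_mul, abs_mul, mul_inv,
          Int.cast_natCast, Nat.abs_cast]
    _ ≤ (g : ℝ)⁻¹ * ((2 * R / supNat b + 1) * (2 * (1 + Real.log (2 * R ^ 2)))) := by
        gcongr
        exact sum_inv_abs_pairDet_le_of_isCoprime (isCoprime_primitivePart hp0) hbR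
    _ ≤ (g : ℝ)⁻¹ * (3 * R / supNat b * (2 * (1 + Real.log (2 * R ^ 2)))) := by
        gcongr
        rw [div_add_one hb.ne']
        gcongr
        linarith
    _ = _ := by
        rw [hsup]
        push_cast
        ring

lemma norm_sum_antitone_smul_le {E : Type*} [NormedAddCommGroup E] [NormedSpace ℝ E] {f : ℕ → ℝ}
    (hf : Antitone f) (hf0 : ∀ n, 0 ≤ f n) {a : ℕ → E} {B : ℝ}
    (ha : ∀ n, ‖∑ i ∈ Finset.range n, a i‖ ≤ B) (n : ℕ) :
    ‖∑ i ∈ Finset.range n, f i • a i‖ ≤ B * f 0 := by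
  rw [Finset.sum_range_by_parts]
  have hlast : ‖f (n - 1) • ∑ i ∈ Finset.range n, a i‖ ≤ f (n - 1) * B := by
    rw [norm_smul, Real.norm_of_nonneg (hf0 _)]
    exact mul_le_mul_of_nonneg_left (ha n) (hf0 _)
  have hdiff : ‖∑ i ∈ Finset.range (n - 1), (f (i + 1) - f i) • ∑ j ∈ Finset.range (i + 1), a j‖ ≤
      ∑ i ∈ Finset.range (n - 1), (f i - f (i + 1)) * B := by
    refine norm_sum_le_of_le _ fun i _ ↦ ?_
    have hi : f (i + 1) ≤ f i := hf i.le_succ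
    rw [norm_smul, Real.norm_of_nonpos (sub_nonpos.mpr hi), neg_sub]
    exact mul_le_mul_of_nonneg_left (ha _) (sub_nonneg.mpr hi)
  rw [← Finset.sum_mul, Finset.sum_range_sub'] at hdiff
  refine (norm_sub_le _ _).trans ?_
  linarith

lemma norm_sum_monotone_smul_le {E : Type*} [NormedAddCommGroup E] [NormedSpace ℝ E] {f : ℕ → ℝ}
    (hf : Monotone f) (hf0 : 0 ≤ f 0) (hf1 : ∀ n, f n ≤ 1) {a : ℕ → E} {B : ℝ}
    (ha : ∀ n, ‖∑ i ∈ Finset.range n, a i‖ ≤ B) (n : ℕ) :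
    ‖∑ i ∈ Finset.range n, f i • a i‖ ≤ 2 * B := by
  have hB : 0 ≤ B := (norm_nonneg _).trans (ha 0)
  have hcompl := norm_sum_antitone_smul_le (f := fun i ↦ 1 - f i)
    (fun i j hij ↦ sub_le_sub_left (hf hij) 1) (fun n ↦ sub_nonneg.mpr (hf1 n)) ha n
  have hsplit : ∑ i ∈ Finset.range n, f i • a i =
      ∑ i ∈ Finset.range n, a i - ∑ i ∈ Finset.range n, (1 - f i) • a i := by
    simp only [sub_smul, one_smul, Finset.sum_sub_distrib, sub_sub_cancel]
  rw [hsplit]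
  refine (norm_sub_le _ _).trans ?_
  nlinarith [ha n, mul_nonneg hB hf0]

lemma sum_range_natCast_add {n : ℕ} [NeZero n] {M : Type*} [AddCommMonoid M] (f : ZMod n → M)
    (a : ZMod n) : ∑ i ∈ Finset.range n, f (i + a) = ∑ x, f x := by
  rw [← Equiv.sum_comp (Equiv.addRight a) f]
  exact Finset.sum_nbij' (fun i ↦ (i : ZMod n)) ZMod.val (fun _ _ ↦ Finset.mem_univ _)
    (fun x _ ↦ Finset.mem_range.mpr x.val_lt)
    (fun i hi ↦ ZMod.val_cast_of_lt (Finset.mem_range.mp hi))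
    (fun x _ ↦ ZMod.natCast_zmod_val x) fun _ _ ↦ rfl

lemma norm_sum_range_natCast_add_le {n : ℕ} [NeZero n] {E : Type*} [NormedAddCommGroup E]
    {f : ZMod n → E} (hf : ∑ x, f x = 0) (hf1 : ∀ x, ‖f x‖ ≤ 1) (a : ZMod n) (N : ℕ) :
    ‖∑ i ∈ Finset.range N, f (i + a)‖ ≤ n := by
  induction N using Nat.strong_induction_on with
  | _ N ih =>
    rcases lt_or_ge N n with h | h
    · calc ‖∑ i ∈ Finset.range N, f (i + a)‖ ≤ ∑ _ ∈ Finset.range N, (1 : ℝ) :=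
            norm_sum_le_of_le _ fun _ _ ↦ hf1 _
        _ ≤ n := by simpa using h.le
    · obtain ⟨M, rfl⟩ := Nat.exists_eq_add_of_le' h
      have hperiod : ∑ i ∈ Finset.range n, f ((M + i : ℕ) + a) = 0 := by
        rw [← hf, ← sum_range_natCast_add f (M + a)]
        exact Finset.sum_congr rfl fun i _ ↦ by push_cast; ring_nf
      rw [Finset.sum_range_add, hperiod, add_zero]
      exact ih M (by have := NeZero.pos n; omega)

lemma norm_sum_chi7_le (N : ℕ) : ‖∑ i ∈ Finset.range N, chi7 (i + 1)‖ ≤ 7 :=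
  norm_sum_range_natCast_add_le (MulChar.sum_eq_zero_of_ne_one chi7_ne_one) chi7.norm_le_one 1 N

lemma centralCoeff_smul (m : ℕ) (j : ℤ) (p : ℤ × ℤ) :
    centralCoeff m (j • p) = chi7 j / j * centralCoeff m p := by
  rcases eq_or_ne j 0 with rfl | hj
  · simp [centralCoeff_zero]
  have hjC : (j : ℂ) ≠ 0 := by exact_mod_cast hj
  rw [centralCoeff, centralCoeff, eps_smul, latticePt_smul, normForm_smul]
  push_cast
  rw [mul_pow, mul_pow]
  field_simp
  ring

lemma centralTerm_smul (m : ℕ) (j : ℤ) (p : ℤ × ℤ) : centralTerm m (j • p) =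
    (poissonTail (m + 1) (2 * π / 7 * (j ^ 2 * normForm p)) / j) • chi7 j * centralCoeff m p := by
  rw [centralTerm, centralCoeff_smul, normForm_smul, real_smul]
  push_cast
  ring

lemma centralTerm_neg (m : ℕ) (p : ℤ × ℤ) : centralTerm m (-p) = centralTerm m p := by
  have h : -p = (-1 : ℤ) • p := by simp
  rw [h, centralTerm, centralTerm, centralCoeff_smul, normForm_smul]
  push_cast
  rw [chi7_neg_one]
  norm_num

lemma pairDet_eq_zero_iff {p q : ℤ × ℤ} (hp : p ≠ 0) :
    pairDet p q = 0 ↔ ∃ j : ℤ, j • primitivePart p = q := by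
  set b := primitivePart p
  have hg : (Int.gcd p.1 p.2 : ℤ) ≠ 0 := by exact_mod_cast (gcd_pos_of_ne_zero hp).ne'
  rw [← gcd_smul_primitivePart p, pairDet_smul_left, mul_eq_zero, or_iff_right hg]
  constructor
  · intro h
    have hdet : b.1 * q.2 - b.2 * q.1 = 0 := h
    obtain ⟨u, v, huv⟩ := isCoprime_primitivePart hp
    refine ⟨u * q.1 + v * q.2, Prod.ext ?_ ?_⟩
    · simp only [Prod.smul_fst, smul_eq_mul]
      linear_combination q.1 * huv + v * hdet
    · simp only [Prod.smul_snd, smul_eq_mul]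
      linear_combination q.2 * huv - u * hdet
  · rintro ⟨j, rfl⟩
    simp only [pairDet, Prod.smul_fst, Prod.smul_snd, smul_eq_mul]
    ring

lemma primitivePart_ne_zero {p : ℤ × ℤ} (hp : p ≠ 0) : primitivePart p ≠ 0 := fun h ↦
  hp (by rw [← gcd_smul_primitivePart p, h, smul_zero])

lemma filter_pairDet_eq_zero (R : ℕ) {p : ℤ × ℤ} (hp : p ≠ 0) :
    (latticeBox R).filter (pairDet p · = 0) =
      (Finset.Icc (-(R / supNat (primitivePart p) : ℕ) : ℤ)
        (R / supNat (primitivePart p) : ℕ)).image (· • primitivePart p) := by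
  have hb := supNat_pos (primitivePart_ne_zero hp)
  have hmem (j : ℤ) : j • primitivePart p ∈ latticeBox R ↔
      j ∈ Finset.Icc (-(R / supNat (primitivePart p) : ℕ) : ℤ)
        (R / supNat (primitivePart p) : ℕ) := by
    rw [mem_latticeBox, supNat_smul, ← Nat.le_div_iff_mul_le hb, Finset.mem_Icc]
    omega
  ext q
  rw [Finset.mem_filter, pairDet_eq_zero_iff hp, Finset.mem_image]
  constructor
  · rintro ⟨hq, j, rfl⟩
    exact ⟨j, (hmem j).mp hq, rfl⟩
  · rintro ⟨j, hj, rfl⟩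
    exact ⟨(hmem j).mpr hj, j, rfl⟩

lemma norm_sum_centralTerm_natCast_smul_le (m K : ℕ) (p : ℤ × ℤ) :
    ‖∑ i ∈ Finset.range K, centralTerm m (((i + 1 : ℕ) : ℤ) • p)‖ ≤ 7 * ‖latticePt p‖⁻¹ := by
  set f : ℕ → ℝ := fun i ↦
    poissonTail (m + 1) (2 * π / 7 * (((i : ℝ) + 1) ^ 2 * normForm p)) / (i + 1)
  have hN : (0 : ℝ) ≤ normForm p := by exact_mod_cast normForm_nonneg p
  have hf0 (i : ℕ) : 0 ≤ f i := div_nonneg (poissonTail_nonneg _ (by positivity)) (by positivity)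
  have hf : Antitone f := fun i j hij ↦ by
    have hij' : (i : ℝ) ≤ j := by exact_mod_cast hij
    refine div_le_div₀ (poissonTail_nonneg _ (by positivity)) ?_ (by positivity) (by linarith)
    refine poissonTail_antitoneOn m (mem_Ici.mpr (by positivity)) (mem_Ici.mpr (by positivity)) ?_
    gcongr
  have hf1 : f 0 ≤ 1 := by
    simp only [f, Nat.cast_zero, zero_add, div_one]
    exact poissonTail_le_one _ (by positivity)
  have hterm (i : ℕ) : centralTerm m (((i + 1 : ℕ) : ℤ) • p) =
      f i • chi7 (i + 1) * centralCoeff m p := by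
    rw [centralTerm_smul]
    push_cast
    rfl
  have hsum := norm_sum_antitone_smul_le hf hf0 norm_sum_chi7_le K
  simp only [hterm]
  rw [← Finset.sum_mul, norm_mul]
  gcongr
  · linarith
  · exact norm_centralCoeff_le m p

lemma norm_sum_parallel_le (m R : ℕ) {p : ℤ × ℤ} (hp : p ≠ 0) :
    ‖∑ q ∈ latticeBox R with pairDet p q = 0, centralTerm m q‖ ≤
      14 * Int.gcd p.1 p.2 * ‖latticePt p‖⁻¹ := by
  set b := primitivePart p
  set K := R / supNat b
  have hg : (Int.gcd p.1 p.2 : ℝ) ≠ 0 := by exact_mod_cast (gcd_pos_of_ne_zero hp).ne'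
  have hnorm : ‖latticePt b‖⁻¹ = Int.gcd p.1 p.2 * ‖latticePt p‖⁻¹ := by
    have h : ‖latticePt p‖ = Int.gcd p.1 p.2 * ‖latticePt b‖ := by
      rw [← Complex.norm_natCast, ← norm_mul, ← Int.cast_natCast, ← latticePt_smul,
        gcd_smul_primitivePart]
    rw [h, mul_inv, mul_inv_cancel_left₀ hg]
  have hsum : ∑ q ∈ latticeBox R with pairDet p q = 0, centralTerm m q =
      2 * ∑ i ∈ Finset.range K, centralTerm m (((i + 1 : ℕ) : ℤ) • b) := by
    rw [filter_pairDet_eq_zero R hp,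
      Finset.sum_image (smul_left_injective ℤ (primitivePart_ne_zero hp)).injOn,
      Finset.sum_Icc_of_even_eq_range (f := fun j : ℤ ↦ centralTerm m (j • b))
        (fun j ↦ by simp only [neg_smul, centralTerm_neg]),
      Finset.sum_range_succ', Nat.cast_zero, zero_smul, centralTerm_zero, add_zero, sub_zero,
      two_nsmul, two_mul]
  calc ‖∑ q ∈ latticeBox R with pairDet p q = 0, centralTerm m q‖
      ≤ 2 * (7 * ‖latticePt b‖⁻¹) := by
        rw [hsum, norm_mul, Complex.norm_two]
        gcongr
        exact norm_sum_centralTerm_natCast_smul_le m K b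
    _ = 14 * Int.gcd p.1 p.2 * ‖latticePt p‖⁻¹ := by rw [hnorm]; ring

lemma norm_sum_monotone_smul_pow_le {f : ℕ → ℝ} (hf : Monotone f) (hf0 : 0 ≤ f 0)
    (hf1 : ∀ n, f n ≤ 1) {w : ℂ} (hw : ‖w‖ ≤ 1) (hw1 : w ≠ 1) (n : ℕ) :
    ‖∑ i ∈ Finset.range n, f i • w ^ i‖ ≤ 4 / ‖1 - w‖ := by
  have hgeom (n : ℕ) : ‖∑ i ∈ Finset.range n, w ^ i‖ ≤ 2 / ‖1 - w‖ := by
    rw [geom_sum_eq hw1, norm_div, norm_sub_rev w 1]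
    gcongr
    calc ‖w ^ n - 1‖ ≤ ‖w‖ ^ n + 1 := by simpa only [norm_pow, norm_one] using norm_sub_le (w ^ n) 1
      _ ≤ 1 + 1 := by gcongr; exact pow_le_one₀ (norm_nonneg _) hw
      _ = 2 := by norm_num
  refine (norm_sum_monotone_smul_le hf hf0 hf1 hgeom n).trans (le_of_eq ?_)
  ring

lemma norm_mul_norm_one_sub_div_conj {z : ℂ} (hz : z ≠ 0) :
    ‖z‖ * ‖1 - z / starRingEnd ℂ z‖ = 2 * |z.im| := by
  have hconj : starRingEnd ℂ z ≠ 0 := (map_ne_zero _).mpr hz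
  rw [← RCLike.norm_conj z, ← norm_mul, mul_sub, mul_one, mul_div_cancel₀ _ hconj, norm_sub_rev,
    sub_conj, norm_mul, norm_I, mul_one, norm_real, Real.norm_eq_abs, abs_mul, abs_two]

lemma latticePt_mul_conj_im (p q : ℤ × ℤ) :
    (latticePt p * starRingEnd ℂ (latticePt q)).im = -(√7 / 2 * pairDet p q) := by
  simp only [latticePt, pairDet, mul_im, add_im, add_re, mul_re, conj_re, conj_im, intCast_re,
    intCast_im, eta_im]
  push_cast
  ring

lemma centralCoeff_mul_conj (m : ℕ) (p q : ℤ × ℤ) {D : ℂ}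
    (hD : D = latticePt p * starRingEnd ℂ (latticePt q)) :
    centralCoeff m p * starRingEnd ℂ (centralCoeff m q) =
      eps p * eps q / starRingEnd ℂ D * (D / starRingEnd ℂ D) ^ m := by
  have hN : (normForm p : ℂ) * normForm q = D * starRingEnd ℂ D := by
    rw [mul_conj, hD, normSq_mul, normSq_conj, normSq_latticePt, normSq_latticePt]
    push_cast; rfl
  have hprod : centralCoeff m p * starRingEnd ℂ (centralCoeff m q) =
      eps p * eps q * D ^ (2 * m + 1) / (D * starRingEnd ℂ D) ^ (m + 1) := by
    rw [← hN, hD]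
    simp only [centralCoeff, map_mul, map_div₀, map_pow, map_intCast]
    rw [mul_pow, mul_pow, div_mul_div_comm]
    ring
  rw [hprod]
  rcases eq_or_ne D 0 with h | h
  · simp [h]
  have hconj : starRingEnd ℂ D ≠ 0 := (map_ne_zero _).mpr h
  rw [div_pow, mul_pow]
  field_simp
  ring

lemma abs_pairDet_le_abs_im (p q : ℤ × ℤ) :
    |(pairDet p q : ℝ)| ≤ |(latticePt p * starRingEnd ℂ (latticePt q)).im| := by
  have h7 : 1 ≤ √7 / 2 := by
    rw [one_le_div two_pos]; exact Real.le_sqrt_of_sq_le (by norm_num)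
  rw [latticePt_mul_conj_im, abs_neg, abs_mul, abs_of_pos (one_pos.trans_le h7)]
  exact le_mul_of_one_le_left (abs_nonneg _) h7

lemma centralTerm_mul_conj (m : ℕ) (p q : ℤ × ℤ) {D : ℂ}
    (hD : D = latticePt p * starRingEnd ℂ (latticePt q)) :
    centralTerm m p * starRingEnd ℂ (centralTerm m q) = eps p * eps q / starRingEnd ℂ D *
      (poissonTail (m + 1) (2 * π / 7 * normForm p) *
        poissonTail (m + 1) (2 * π / 7 * normForm q)) • (D / starRingEnd ℂ D) ^ m := by
  rw [centralTerm, centralTerm, map_mul, conj_ofReal, mul_mul_mul_comm,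
    centralCoeff_mul_conj m p q hD, real_smul]
  push_cast
  ring

lemma norm_sum_centralTerm_mul_conj_le {p q : ℤ × ℤ} (hdet : pairDet p q ≠ 0) (M : ℕ) :
    ‖∑ m ∈ Finset.range M, centralTerm m p * starRingEnd ℂ (centralTerm m q)‖ ≤
      2 * |(pairDet p q : ℝ)|⁻¹ := by
  obtain ⟨D, hD⟩ : ∃ D, D = latticePt p * starRingEnd ℂ (latticePt q) := ⟨_, rfl⟩
  have hdet' : 0 < |(pairDet p q : ℝ)| := abs_pos.mpr (by exact_mod_cast hdet)
  have habs : |(pairDet p q : ℝ)| ≤ |D.im| := hD ▸ abs_pairDet_le_abs_im p q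
  have hD0 : D ≠ 0 := by
    rintro rfl
    rw [zero_im, abs_zero] at habs
    exact habs.not_gt hdet'
  have hprod := norm_mul_norm_one_sub_div_conj hD0
  simp only [centralTerm_mul_conj _ p q hD]
  set w := D / starRingEnd ℂ D
  have hw : ‖w‖ ≤ 1 := by rw [norm_div, RCLike.norm_conj]; exact div_self_le_one _
  have hw1 : w ≠ 1 := fun h ↦ by
    rw [h, sub_self, norm_zero, mul_zero] at hprod
    linarith
  have hyp := two_pi_div_seven_mul_normForm_nonneg p
  have hyq := two_pi_div_seven_mul_normForm_nonneg q
  set f : ℕ → ℝ := fun m ↦ poissonTail (m + 1) (2 * π / 7 * normForm p) *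
    poissonTail (m + 1) (2 * π / 7 * normForm q)
  have hf : Monotone f := fun i j hij ↦
    mul_le_mul (poissonTail_mono hyp (by omega)) (poissonTail_mono hyq (by omega))
      (poissonTail_nonneg _ hyq) (poissonTail_nonneg _ hyp)
  have hf0 : 0 ≤ f 0 := mul_nonneg (poissonTail_nonneg _ hyp) (poissonTail_nonneg _ hyq)
  have hf1 (m : ℕ) : f m ≤ 1 := mul_le_one₀ (poissonTail_le_one _ hyp) (poissonTail_nonneg _ hyq)
    (poissonTail_le_one _ hyq)
  have hcoeff : ‖(eps p * eps q / starRingEnd ℂ D : ℂ)‖ ≤ ‖D‖⁻¹ := by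
    rw [norm_div, norm_mul, RCLike.norm_conj, ← one_div]
    gcongr
    exact mul_le_one₀ (norm_eps_le_one p) (norm_nonneg _) (norm_eps_le_one q)
  rw [← Finset.mul_sum, norm_mul]
  calc ‖(eps p * eps q / starRingEnd ℂ D : ℂ)‖ * ‖∑ m ∈ Finset.range M, f m • w ^ m‖
      ≤ ‖D‖⁻¹ * (4 / ‖1 - w‖) := by
        gcongr
        exact norm_sum_monotone_smul_pow_le hf hf0 hf1 hw hw1 M
    _ = 2 * |D.im|⁻¹ := by
        rw [inv_mul_eq_div, div_div, mul_comm ‖1 - w‖, hprod]; ring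
    _ ≤ 2 * |(pairDet p q : ℝ)|⁻¹ := by gcongr

lemma norm_sum_parallel_pairs_le (m R : ℕ) :
    ‖∑ p ∈ latticeBox R, centralTerm m p *
        starRingEnd ℂ (∑ q ∈ latticeBox R with pairDet p q = 0, centralTerm m q)‖ ≤
      224 * (1 + Real.log R) ^ 2 := by
  calc ‖∑ p ∈ latticeBox R, centralTerm m p *
        starRingEnd ℂ (∑ q ∈ latticeBox R with pairDet p q = 0, centralTerm m q)‖
      ≤ ∑ p ∈ latticeBox R, 14 * ((Int.gcd p.1 p.2 : ℝ) / normForm p) := by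
        refine norm_sum_le_of_le _ fun p _ ↦ ?_
        rcases eq_or_ne p 0 with rfl | hp
        · simp [centralTerm_zero]
        rw [norm_mul, RCLike.norm_conj]
        calc _ ≤ ‖latticePt p‖⁻¹ * (14 * Int.gcd p.1 p.2 * ‖latticePt p‖⁻¹) := by
              gcongr
              · exact norm_centralTerm_le_inv_norm m p
              · exact norm_sum_parallel_le m R hp
          _ = _ := by rw [← norm_latticePt_sq]; ring
    _ ≤ 224 * (1 + Real.log R) ^ 2 := by
        rw [← Finset.mul_sum]
        linarith [sum_gcd_div_normForm_le R]

lemma norm_sum_nonparallel_pairs_le (M R : ℕ) :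
    ‖∑ p ∈ latticeBox R, ∑ q ∈ latticeBox R with pairDet p q ≠ 0,
        ∑ m ∈ Finset.range M, centralTerm m p * starRingEnd ℂ (centralTerm m q)‖ ≤
      96 * R ^ 2 * (1 + Real.log (2 * R ^ 2)) := by
  calc ‖∑ p ∈ latticeBox R, ∑ q ∈ latticeBox R with pairDet p q ≠ 0,
        ∑ m ∈ Finset.range M, centralTerm m p * starRingEnd ℂ (centralTerm m q)‖
      ≤ ∑ p ∈ latticeBox R, 12 * R * (1 + Real.log (2 * R ^ 2)) * (supNat p : ℝ)⁻¹ := by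
        refine norm_sum_le_of_le _ fun p hp ↦ ?_
        calc _ ≤ ∑ q ∈ latticeBox R with pairDet p q ≠ 0, 2 * |(pairDet p q : ℝ)|⁻¹ :=
              norm_sum_le_of_le _ fun q hq ↦
                norm_sum_centralTerm_mul_conj_le (Finset.mem_filter.mp hq).2 M
          _ ≤ ∑ q ∈ latticeBox R, 2 * |(pairDet p q : ℝ)|⁻¹ :=
              Finset.sum_le_sum_of_subset_of_nonneg (Finset.filter_subset _ _)
                fun q _ _ ↦ by positivity
          _ ≤ _ := by
              rw [← Finset.mul_sum]
              linarith [sum_inv_abs_pairDet_le hp]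
    _ = 96 * R ^ 2 * (1 + Real.log (2 * R ^ 2)) := by
        rw [← Finset.mul_sum, sum_latticeBox_inv_supNat]; ring

lemma norm_sq_sum_eq_sum_mul_conj_add {ι : Type*} (s : Finset ι) (c : ι → ℂ) (r : ι → ι → Prop)
    [∀ p, DecidablePred (r p)] :
    ((‖∑ p ∈ s, c p‖ ^ 2 : ℝ) : ℂ) = ∑ p ∈ s, c p * starRingEnd ℂ (∑ q ∈ s with r p q, c q) +
      ∑ p ∈ s, ∑ q ∈ s with ¬ r p q, c p * starRingEnd ℂ (c q) := by
  rw [ofReal_pow, ← mul_conj', map_sum, Finset.sum_mul_sum, ← Finset.sum_add_distrib]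
  refine Finset.sum_congr rfl fun p _ ↦ ?_
  rw [map_sum, Finset.mul_sum, Finset.sum_filter_add_sum_filter_not]

lemma sum_norm_sq_sum_centralTerm_le (M R : ℕ) :
    ∑ m ∈ Finset.range M, ‖∑ p ∈ latticeBox R, centralTerm m p‖ ^ 2 ≤
      224 * M * (1 + Real.log R) ^ 2 + 96 * R ^ 2 * (1 + Real.log (2 * R ^ 2)) := by
  have hsplit : ((∑ m ∈ Finset.range M, ‖∑ p ∈ latticeBox R, centralTerm m p‖ ^ 2 : ℝ) : ℂ) =
      ∑ m ∈ Finset.range M, ∑ p ∈ latticeBox R, centralTerm m p *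
        starRingEnd ℂ (∑ q ∈ latticeBox R with pairDet p q = 0, centralTerm m q) +
      ∑ p ∈ latticeBox R, ∑ q ∈ latticeBox R with pairDet p q ≠ 0,
        ∑ m ∈ Finset.range M, centralTerm m p * starRingEnd ℂ (centralTerm m q) := by
    rw [ofReal_sum, Finset.sum_congr rfl fun m _ ↦
      norm_sq_sum_eq_sum_mul_conj_add _ (centralTerm m) (fun p q ↦ pairDet p q = 0),
      Finset.sum_add_distrib, Finset.sum_comm (s := Finset.range M) (f := fun m p ↦
        ∑ q ∈ latticeBox R with ¬ pairDet p q = 0, _)]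
    congr 1
    exact Finset.sum_congr rfl fun p _ ↦ Finset.sum_comm
  rw [← Real.norm_of_nonneg (by positivity :
    0 ≤ ∑ m ∈ Finset.range M, ‖∑ p ∈ latticeBox R, centralTerm m p‖ ^ 2), ← norm_real, hsplit]
  refine (norm_add_le _ _).trans (add_le_add ?_ (norm_sum_nonparallel_pairs_le M R))
  calc _ ≤ ∑ m ∈ Finset.range M, 224 * (1 + Real.log R) ^ 2 :=
        norm_sum_le_of_le _ fun m _ ↦ norm_sum_parallel_pairs_le m R
    _ = 224 * M * (1 + Real.log R) ^ 2 := by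
        rw [Finset.sum_const, Finset.card_range, nsmul_eq_mul]; ring

/-- A bound, uniform in the weight, for the part of the approximate functional equation that lies
outside the box of radius `truncRadius`. -/
noncomputable def tailBound : ℝ := ∑' p : ℤ × ℤ, Real.exp (-(2 * π / 7 * normForm p) * (1 / 4))

lemma tailBound_nonneg : 0 ≤ tailBound := tsum_nonneg fun _ ↦ (Real.exp_pos _).le

lemma norm_centralTerm_le_exp {m R : ℕ} (h : 4 * ((m : ℝ) + 1) ≤ π / 7 * (R + 1) ^ 2)
    {p : ℤ × ℤ} (hp : p ∉ latticeBox R) :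
    ‖centralTerm m p‖ ≤ Real.exp (-(2 * π / 7 * normForm p) * (1 / 4)) := by
  have hsup : (R + 1 : ℝ) ≤ supNat p := by
    rw [mem_latticeBox, not_le] at hp
    exact_mod_cast hp
  have hmean : 4 * ((m + 1 : ℕ) : ℝ) ≤ 2 * π / 7 * normForm p := by
    push_cast
    calc 4 * ((m : ℝ) + 1) ≤ π / 7 * (R + 1) ^ 2 := h
      _ ≤ π / 7 * (supNat p : ℝ) ^ 2 := by gcongr
      _ = 2 * π / 7 * ((supNat p : ℝ) ^ 2 / 2) := by ring
      _ ≤ 2 * π / 7 * normForm p := by gcongr; exact supNat_sq_div_two_le_normForm p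
  calc ‖centralTerm m p‖ ≤ poissonTail (m + 1) (2 * π / 7 * normForm p) :=
        norm_centralTerm_le_poissonTail m p
    _ ≤ Real.exp (-(2 * π / 7 * normForm p / 4)) := poissonTail_le_of_le hmean
    _ = _ := by congr 1; ring

lemma norm_tsum_centralTerm_sub_le {m R : ℕ} (h : 4 * ((m : ℝ) + 1) ≤ π / 7 * (R + 1) ^ 2) :
    ‖∑' p, centralTerm m p - ∑ p ∈ latticeBox R, centralTerm m p‖ ≤ tailBound := by
  have hexp : Summable fun p ↦ Real.exp (-(2 * π / 7 * normForm p) * (1 / 4)) := by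
    simpa only [pow_zero, mul_one] using summable_exp_mul_norm_pow (by norm_num : (0 : ℝ) < 1 / 4) 0
  have hnorm := (summable_centralTerm m).norm.subtype (↑(latticeBox R) : Set (ℤ × ℤ))ᶜ
  rw [← (summable_centralTerm m).sum_add_tsum_compl (s := latticeBox R), add_sub_cancel_left]
  calc ‖∑' p : ↥(↑(latticeBox R) : Set (ℤ × ℤ))ᶜ, centralTerm m p‖
      ≤ ∑' p : ↥(↑(latticeBox R) : Set (ℤ × ℤ))ᶜ, ‖centralTerm m p‖ := norm_tsum_le_tsum_norm hnorm
    _ ≤ ∑' p : ↥(↑(latticeBox R) : Set (ℤ × ℤ))ᶜ,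
          Real.exp (-(2 * π / 7 * normForm p) * (1 / 4)) :=
        hnorm.tsum_le_tsum (fun p ↦ norm_centralTerm_le_exp h p.2) (hexp.subtype _)
    _ ≤ tailBound := hexp.tsum_subtype_le _ _ fun p ↦ (Real.exp_pos _).le

/-- The radius of the box to which the approximate functional equations of the first `M` central
values are truncated. -/
def truncRadius (M : ℕ) : ℕ := 4 * (Nat.sqrt M + 1)

lemma four_mul_le_truncRadius {m M : ℕ} (hm : m < M) :
    4 * ((m : ℝ) + 1) ≤ π / 7 * ((truncRadius M : ℝ) + 1) ^ 2 := by
  have hmM : (m : ℝ) + 1 ≤ M := by exact_mod_cast hm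
  have hsqrt : (M : ℝ) ≤ ((Nat.sqrt M : ℝ) + 1) ^ 2 := by
    exact_mod_cast (Nat.lt_succ_sqrt' M).le
  have hpi := Real.pi_gt_three.le
  calc 4 * ((m : ℝ) + 1) ≤ 3 / 7 * (4 * ((Nat.sqrt M : ℝ) + 1)) ^ 2 := by linarith
    _ = 3 / 7 * (truncRadius M : ℝ) ^ 2 := by rw [truncRadius]; push_cast; rfl
    _ ≤ π / 7 * ((truncRadius M : ℝ) + 1) ^ 2 := by gcongr; linarith

lemma one_le_truncRadius (M : ℕ) : (1 : ℝ) ≤ truncRadius M := by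
  rw [truncRadius, Nat.one_le_cast]; omega

lemma truncRadius_le {M : ℕ} (hM : 1 ≤ M) : (truncRadius M : ℝ) ≤ 8 * √M := by
  have hone : (1 : ℝ) ≤ Nat.sqrt M := by exact_mod_cast Nat.sqrt_pos.mpr hM
  have hsqrt : (Nat.sqrt M : ℝ) ≤ √M := Real.nat_sqrt_le_real_sqrt
  rw [truncRadius]
  push_cast
  linarith

lemma truncRadius_sq_le {M : ℕ} (hM : 1 ≤ M) : (truncRadius M : ℝ) ^ 2 ≤ 64 * M := by
  have h : (truncRadius M : ℝ) ^ 2 ≤ (8 * √(M : ℝ)) ^ 2 := by gcongr; exact truncRadius_le hM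
  rw [mul_pow, Real.sq_sqrt M.cast_nonneg] at h
  linarith

lemma one_le_two_mul_log {n : ℕ} (hn : 2 ≤ n) : 1 ≤ 2 * Real.log n := by
  have h : Real.log 2 ≤ Real.log n := Real.log_le_log two_pos (by exact_mod_cast hn)
  linarith [Real.log_two_gt_d9]

lemma one_add_log_truncRadius_sq_le {M : ℕ} (hM : 2 ≤ M) :
    1 + Real.log (2 * truncRadius M ^ 2) ≤ 10 * Real.log M := by
  have hR := one_le_truncRadius M
  have hlog : Real.log (2 * truncRadius M ^ 2) ≤ Real.log ((M : ℝ) ^ 8) := by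
    refine Real.log_le_log (by positivity) ?_
    calc 2 * (truncRadius M : ℝ) ^ 2 ≤ 2 ^ 7 * M := by
          linarith [truncRadius_sq_le (one_le_two.trans hM)]
      _ ≤ (M : ℝ) ^ 7 * M := by gcongr; exact_mod_cast hM
      _ = (M : ℝ) ^ 8 := (pow_succ _ _).symm
  rw [Real.log_pow] at hlog
  push_cast at hlog
  linarith [one_le_two_mul_log hM]

lemma one_add_log_truncRadius_le {M : ℕ} (hM : 2 ≤ M) :
    1 + Real.log (truncRadius M) ≤ 10 * Real.log M := by
  have hR := one_le_truncRadius M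
  refine le_trans ?_ (one_add_log_truncRadius_sq_le hM)
  gcongr
  nlinarith

lemma norm_heckeL_center_le_truncated {m M : ℕ} (hm : m < M) :
    ‖heckeL (2 * m + 1) (1 / 2)‖ ≤
      ‖∑ p ∈ latticeBox (truncRadius M), centralTerm m p‖ + tailBound := by
  refine (norm_heckeL_center_le m).trans ?_
  rw [← sub_le_iff_le_add']
  exact (norm_sub_norm_le _ _).trans (norm_tsum_centralTerm_sub_le (four_mul_le_truncRadius hm))

lemma norm_heckeL_center_le_sqrt (m : ℕ) :
    ‖heckeL (2 * m + 1) (1 / 2)‖ ≤ (128 + tailBound) * √(m + 1) := by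
  have hR := truncRadius_le m.succ_pos
  have hsqrt : 1 ≤ √((m : ℝ) + 1) := Real.one_le_sqrt.mpr (by linarith [m.cast_nonneg (α := ℝ)])
  rw [Nat.cast_succ] at hR
  calc ‖heckeL (2 * m + 1) (1 / 2)‖
      ≤ ‖∑ p ∈ latticeBox (truncRadius (m + 1)), centralTerm m p‖ + tailBound :=
        norm_heckeL_center_le_truncated m.lt_succ_self
    _ ≤ 16 * truncRadius (m + 1) + tailBound * √(m + 1) := by
        refine add_le_add ?_ (le_mul_of_one_le_right tailBound_nonneg hsqrt)
        exact (norm_sum_le_of_le _ fun p _ ↦ norm_centralTerm_le_inv_norm m p).trans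
          (sum_latticeBox_inv_norm_le _)
    _ ≤ (128 + tailBound) * √(m + 1) := by linarith

lemma sum_norm_sq_truncated_le {M : ℕ} (hM : 2 ≤ M) :
    ∑ m ∈ Finset.range M, ‖∑ p ∈ latticeBox (truncRadius M), centralTerm m p‖ ^ 2 ≤
      145280 * (M * Real.log M ^ 2) := by
  have hlog := one_le_two_mul_log hM
  have hR := one_le_truncRadius M
  have hlogR2 : 0 ≤ Real.log (2 * truncRadius M ^ 2) := Real.log_nonneg (by nlinarith)
  calc ∑ m ∈ Finset.range M, ‖∑ p ∈ latticeBox (truncRadius M), centralTerm m p‖ ^ 2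
      ≤ 224 * M * (1 + Real.log (truncRadius M)) ^ 2 +
          96 * truncRadius M ^ 2 * (1 + Real.log (2 * truncRadius M ^ 2)) :=
        sum_norm_sq_sum_centralTerm_le M (truncRadius M)
    _ ≤ 224 * M * (10 * Real.log M) ^ 2 + 96 * (64 * M) * (10 * Real.log M) := by
        gcongr
        · exact one_add_log_truncRadius_le hM
        · exact truncRadius_sq_le (one_le_two.trans hM)
        · exact one_add_log_truncRadius_sq_le hM
    _ ≤ 224 * M * (10 * Real.log M) ^ 2 +
          96 * (64 * M) * (10 * Real.log M) * (2 * Real.log M) :=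
        add_le_add le_rfl (le_mul_of_one_le_right (by positivity) hlog)
    _ = 145280 * (M * Real.log M ^ 2) := by ring

lemma sum_norm_sq_heckeL_center_le {M : ℕ} (hM : 2 ≤ M) :
    ∑ m ∈ Finset.range M, ‖heckeL (2 * m + 1) (1 / 2)‖ ^ 2 ≤
      (290560 + 8 * tailBound ^ 2) * (M * Real.log M ^ 2) := by
  have hlog : (1 : ℝ) ≤ (2 * Real.log M) ^ 2 := one_le_pow₀ (one_le_two_mul_log hM)
  calc ∑ m ∈ Finset.range M, ‖heckeL (2 * m + 1) (1 / 2)‖ ^ 2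
      ≤ ∑ m ∈ Finset.range M,
          2 * (‖∑ p ∈ latticeBox (truncRadius M), centralTerm m p‖ ^ 2 + tailBound ^ 2) := by
        refine Finset.sum_le_sum fun m hm ↦ le_trans ?_ add_sq_le
        gcongr
        exact norm_heckeL_center_le_truncated (Finset.mem_range.mp hm)
    _ = 2 * ∑ m ∈ Finset.range M, ‖∑ p ∈ latticeBox (truncRadius M), centralTerm m p‖ ^ 2 +
          2 * (M * tailBound ^ 2) * 1 := by
        rw [← Finset.mul_sum, Finset.sum_add_distrib, Finset.sum_const, Finset.card_range,
          nsmul_eq_mul]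
        ring
    _ ≤ 2 * (145280 * (M * Real.log M ^ 2)) + 2 * (M * tailBound ^ 2) * (2 * Real.log M) ^ 2 := by
        gcongr
        exact sum_norm_sq_truncated_le hM
    _ = (290560 + 8 * tailBound ^ 2) * (M * Real.log M ^ 2) := by ring

lemma norm_moment_two_le (N : ℕ) : ‖moment 2 N‖ ≤
    (N : ℝ)⁻¹ * ∑ m ∈ Finset.range (2 * N), ‖heckeL (2 * m + 1) (1 / 2)‖ ^ 2 := by
  have hmaps : ∀ n ∈ Finset.Icc 1 N, 2 * (n - 1) ∈ Finset.range (2 * N) := fun n hn ↦ by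
    rw [Finset.mem_Icc] at hn
    rw [Finset.mem_range]
    omega
  have hinj : Set.InjOn (fun n ↦ 2 * (n - 1)) (Finset.Icc 1 N) := fun i hi j hj hij ↦ by
    simp only [Finset.coe_Icc, mem_Icc] at hi hj hij
    omega
  rw [moment, norm_mul, norm_div, norm_one, norm_natCast, one_div]
  gcongr
  calc ‖∑ n ∈ Finset.Icc 1 N, heckeL (4 * n - 3) (1 / 2) ^ 2‖
      ≤ ∑ n ∈ Finset.Icc 1 N, ‖heckeL (2 * (2 * (n - 1)) + 1) (1 / 2)‖ ^ 2 := by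
        refine norm_sum_le_of_le _ fun n hn ↦ ?_
        rw [norm_pow, show 4 * n - 3 = 2 * (2 * (n - 1)) + 1 by
          have := (Finset.mem_Icc.mp hn).1; omega]
    _ ≤ ∑ m ∈ Finset.range (2 * N), ‖heckeL (2 * m + 1) (1 / 2)‖ ^ 2 := by
        rw [← Finset.sum_image (f := fun m ↦ ‖heckeL (2 * m + 1) (1 / 2)‖ ^ 2) hinj]
        exact Finset.sum_le_sum_of_subset_of_nonneg (Finset.image_subset_iff.mpr hmaps)
          fun _ _ _ ↦ by positivity

lemma norm_moment_two_le_of_sum_norm_sq_le {C : ℝ}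
    (hC : ∀ M : ℕ, 2 ≤ M → ∑ m ∈ Finset.range M, ‖heckeL (2 * m + 1) (1 / 2)‖ ^ 2 ≤
      C * (M * Real.log M ^ 2)) {N : ℕ} (hN : 2 ≤ N) :
    ‖moment 2 N‖ ≤ 8 * C * Real.log N ^ 2 := by
  have hNpos : (0 : ℝ) < N := by exact_mod_cast two_pos.trans_le hN
  have hlog := one_le_two_mul_log hN
  have hlog2 : Real.log ((2 * N : ℕ) : ℝ) ≤ 2 * Real.log N := by
    rw [Nat.cast_mul, Nat.cast_two, Real.log_mul two_ne_zero hNpos.ne', two_mul]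
    gcongr
    exact_mod_cast hN
  have hC0 : 0 ≤ C := by
    refine nonneg_of_mul_nonneg_left
      ((Finset.sum_nonneg fun _ _ ↦ by positivity).trans (hC N hN)) ?_
    have : 0 < Real.log N := by linarith
    positivity
  calc ‖moment 2 N‖
      ≤ (N : ℝ)⁻¹ * ∑ m ∈ Finset.range (2 * N), ‖heckeL (2 * m + 1) (1 / 2)‖ ^ 2 :=
        norm_moment_two_le N
    _ ≤ (N : ℝ)⁻¹ * (C * ((2 * N : ℕ) * Real.log (2 * N : ℕ) ^ 2)) := by
        gcongr
        exact hC _ (by omega)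
    _ ≤ (N : ℝ)⁻¹ * (C * ((2 * N : ℕ) * (2 * Real.log N) ^ 2)) := by
        gcongr
    _ = 8 * C * Real.log N ^ 2 := by push_cast; field_simp; ring

lemma norm_heckeL_le_of_norm_le_sqrt {C : ℝ}
    (hC : ∀ m : ℕ, ‖heckeL (2 * m + 1) (1 / 2)‖ ≤ C * √(m + 1)) {n : ℕ} (hn : 2 ≤ n) :
    ‖heckeL (4 * n - 3) (1 / 2)‖ ≤ 4 * C * (√n * Real.log n) := by
  obtain ⟨i, rfl⟩ := Nat.exists_eq_add_of_le' (one_le_two.trans hn)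
  have hC0 : 0 ≤ C := nonneg_of_mul_nonneg_left ((norm_nonneg _).trans (hC 0)) (by positivity)
  have hlog := one_le_two_mul_log hn
  have hsqrt : √((2 * i : ℕ) + 1 : ℝ) ≤ 2 * √((i + 1 : ℕ) : ℝ) := by
    rw [← Real.sqrt_sq (zero_le_two (α := ℝ)), ← Real.sqrt_mul (sq_nonneg _)]
    gcongr
    push_cast
    linarith [i.cast_nonneg (α := ℝ)]
  calc ‖heckeL (4 * (i + 1) - 3) (1 / 2)‖ = ‖heckeL (2 * (2 * i) + 1) (1 / 2)‖ := by
        rw [show 4 * (i + 1) - 3 = 2 * (2 * i) + 1 by omega]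
    _ ≤ C * √((2 * i : ℕ) + 1) := hC (2 * i)
    _ ≤ C * (2 * √((i + 1 : ℕ) : ℝ)) := by gcongr
    _ ≤ C * (2 * √((i + 1 : ℕ) : ℝ)) * (2 * Real.log (i + 1 : ℕ)) :=
        le_mul_of_one_le_right (by positivity) hlog
    _ = _ := by ring

theorem theorem2_general :
    (∀ k : ℕ, Odd k → IsHeckeL k (heckeL k)) ∧
    (∃ C : ℝ, ∀ M : ℕ, 2 ≤ M →
      ∑ m ∈ Finset.range M, ‖heckeL (2 * m + 1) (1 / 2)‖ ^ 2 ≤ C * (M * Real.log M ^ 2)) ∧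
    (∃ C : ℝ, ∀ m : ℕ, ‖heckeL (2 * m + 1) (1 / 2)‖ ≤ C * √(m + 1)) :=
  ⟨fun _ hk ↦ isHeckeL_heckeL hk, ⟨_, fun _ hM ↦ sum_norm_sq_heckeL_center_le hM⟩,
    ⟨_, norm_heckeL_center_le_sqrt⟩⟩

theorem theorem2 :
    (∀ n : ℕ, 1 ≤ n → IsHeckeL (4 * n - 3) (heckeL (4 * n - 3))) ∧
    (∃ C : ℝ, ∀ N : ℕ, 2 ≤ N → ‖moment 2 N‖ ≤ C * Real.log N ^ 2) ∧
    (∃ C : ℝ, ∀ n : ℕ, 2 ≤ n →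
      ‖heckeL (4 * n - 3) (1 / 2)‖ ≤ C * (Real.sqrt n * Real.log n)) := by
  obtain ⟨hL, ⟨C, hC⟩, C', hC'⟩ := theorem2_general
  exact ⟨fun n hn ↦ hL _ ⟨2 * (n - 1), by omega⟩,
    ⟨8 * C, fun _ hN ↦ norm_moment_two_le_of_sum_norm_sq_le hC hN⟩,
    ⟨4 * C', fun _ hn ↦ norm_heckeL_le_of_norm_le_sqrt hC' hn⟩⟩
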